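/- Let $\nu,D\in\mathbb{N}$, let $\Lambda\subset\mathbb{Z}^\nu$ be finite, let $d$ be the $\ell^1$-metric on $\mathbb{Z}^\nu$, and let $\mathcal{H}_\Lambda=\bigotimes_{x\in\Lambda}\mathbb{C}^D$ and $\mathcal{A}_\Lambda=\mathcal{B}(\mathcal{H}_\Lambda)$ with the operator norm. For $X\subset\Lambda$ let $\mathcal{A}_X\subset\mathcal{A}_\Lambda$ be the set of operators supported in $X$, i.e. those of the form $A\otimes\mathbf{1}_{\Lambda\setminus X}$ with $A\in\mathcal{B}(\bigotimes_{x\in X}\mathbb{C}^D)$, and let $X_r=\{x\in\Lambda : \operatorname{dist}(x,X)\le r\}$ (so $\emptyset_r=\emptyset$). Let $\beta\in(0,\infty)$, let $H\in\mathcal{A}_\Lambda$ be self-adjoint, let $X\subset\Lambda$, and let $V\in\mathcal{A}_X$ be self-adjoint. For $s\in[0,1]$ put $H(s)=H+sV$ and $\rho_\beta(s)=e^{-\beta H(s)}/\operatorname{tr}(e^{-\beta H(s)})$. Suppose that there is a function $\zeta_{\mathrm{LR}}$, assigning to subsets $Z,W\subset\Lambda$ and $t\in[0,\infty)$ a number $\zeta_{\mathrm{LR}}(Z,W,t)\in[0,\infty)$,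 such that for all $s\in[0,1]$, all $Z,W\subset\Lambda$, $A\in\mathcal{A}_Z$, $C\in\mathcal{A}_W$ and $t\in\mathbb{R}$, $$\big\|[e^{-itH(s)}\,A\,e^{itH(s)},\,C]\big\|\le\|A\|\,\|C\|\,\zeta_{\mathrm{LR}}(Z,W,|t|).$$ For $r\ge 0$ define $$\zeta_{\mathrm{QBP}}(X,r)=\min\Big\{2,\ \inf_{T\ge0}\Big(\|\zeta_{\mathrm{LR}}(X,\Lambda\setminus X_r,|\cdot|)\|_{L^\infty([-T,T])}+4e^{-\pi T/\beta}\Big)\Big\},$$ where the $L^\infty$-norm is the essential supremum with respect to Lebesgue measure, possibly $+\infty$. For a state $\rho$ on $\mathcal{A}_\Lambda$ and $Z,Y\subset\Lambda$ define $$\operatorname{Cov}_\rho(Z;Y)=\sup\big\{|\operatorname{tr}(\rho AC)-\operatorname{tr}(\rho A)\operatorname{tr}(\rho C)| : A\in\mathcal{A}_Z,\ C\in\mathcal{A}_Y,\ \|A\|=\|C\|=1\big\}.$$ Then for all $Y\subset\Lambda$, all $B\in\mathcal{A}_Y$ and all $r\ge0$, $$\big|\operatorname{tr}(\rho_\beta(0)B)-\operatorname{tr}(\rho_\beta(1)B)\big|\le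 e^{2\beta\|V\|}\,\|B\|\,\Big(\operatorname{Cov}_{\rho_\beta(0)}(X_r;Y)+4\beta\,\|V\|\,\zeta_{\mathrm{QBP}}(X,r)\Big).$$ -/

import Mathlib

open scoped NNReal ENNReal Kronecker Matrix.Norms.L2Operator

noncomputable section

namespace SpinLattice

/-- The `ℓ¹`-distance on the lattice `ℤ^ν`. -/
def latticeDist {ν : ℕ} (x y : Fin ν → ℤ) : ℤ := ∑ i, |x i - y i|

/-- The algebra `𝒜_Λ` of operators on `ℋ_Λ = ⨂_{x ∈ Λ} ℂ^D`, written as matrices in the product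
basis of `ℋ_Λ`, which is indexed by the configurations `Λ → Fin D`. The norm on it is the operator
norm for the Euclidean norm on `ℋ_Λ` (scope `Matrix.Norms.L2Operator`), `star` is the adjoint. -/
abbrev Op (D : ℕ) {ν : ℕ} (Λ : Finset (Fin ν → ℤ)) : Type :=
  Matrix (Λ → Fin D) (Λ → Fin D) ℂ

variable {ν D : ℕ} {Λ : Finset (Fin ν → ℤ)}

/-- The identification `A ↦ A ⊗ 1_{Λ \ X}` of operators on `⨂_{x ∈ X} ℂ^D` with operators on
`ℋ_Λ`, for `X ⊆ Λ`. -/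
def embed (X : Finset Λ)
    (A : Matrix ({x : Λ // x ∈ X} → Fin D) ({x : Λ // x ∈ X} → Fin D) ℂ) : Op D Λ :=
  (A ⊗ₖ (1 : Matrix ({x : Λ // x ∉ X} → Fin D) ({x : Λ // x ∉ X} → Fin D) ℂ)).submatrix
    (Equiv.piEquivPiSubtypeProd (fun x : Λ => x ∈ X) (fun _ => Fin D))
    (Equiv.piEquivPiSubtypeProd (fun x : Λ => x ∈ X) (fun _ => Fin D))

/-- `𝒜_X` as a subset of `𝒜_Λ`: the operators supported in `X`. -/
def localAlgebra (D : ℕ) (X : Finset Λ) : Set (Op D Λ) := Set.range (embed X)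

open Classical in
/-- The `r`-neighbourhood `X_r = {x ∈ Λ | dist(x, X) ≤ r}` in `Λ`. As `X` is finite, the distance
is attained; for empty `X` it is infinite and `X_r` is empty. -/
def nbhd (X : Finset Λ) (r : ℝ) : Finset Λ :=
  Finset.univ.filter fun x : Λ => ∃ y ∈ X, (latticeDist (x : Fin ν → ℤ) (y : Fin ν → ℤ) : ℝ) ≤ r

/-- The Gibbs state `e^{-βH} / tr e^{-βH}`. -/
def gibbs (β : ℝ) (H : Op D Λ) : Op D Λ :=
  (NormedSpace.exp (-(β • H))).trace⁻¹ • NormedSpace.exp (-(β • H))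

/-- The covariance `tr(ρ A B) - tr(ρ A) tr(ρ B)`. -/
def cov (ρ A B : Op D Λ) : ℂ :=
  (ρ * A * B).trace - (ρ * A).trace * (ρ * B).trace

/-- `Cov_ρ(X;Y)`, the supremum of `|Cov_ρ(A,B)|` over all `A ∈ 𝒜_X`, `B ∈ 𝒜_Y` of norm one.
The set is bounded above, see `bddAbove_covSet`. -/
def covSup (ρ : Op D Λ) (X Y : Finset Λ) : ℝ :=
  sSup {c : ℝ | ∃ A ∈ localAlgebra D X, ∃ B ∈ localAlgebra D Y,
    ‖A‖ = 1 ∧ ‖B‖ = 1 ∧ c = ‖cov ρ A B‖}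

theorem bddAbove_covSet (ρ : Op D Λ) (X Y : Finset Λ) :
    BddAbove {c : ℝ | ∃ A ∈ localAlgebra D X, ∃ B ∈ localAlgebra D Y,
      ‖A‖ = 1 ∧ ‖B‖ = 1 ∧ c = ‖cov ρ A B‖} := by
  have hc : Continuous fun p : Op D Λ × Op D Λ => ‖cov ρ p.1 p.2‖ := by
    unfold cov
    fun_prop
  have hK : IsCompact (Metric.closedBall (0 : Op D Λ) 1 ×ˢ Metric.closedBall (0 : Op D Λ) 1) :=
    haveI : ProperSpace (Op D Λ) := FiniteDimensional.proper ℂ _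
    (isCompact_closedBall _ _).prod (isCompact_closedBall _ _)
  refine (hK.image hc).bddAbove.mono ?_
  rintro c ⟨A, -, B, -, hA, hB, rfl⟩
  exact ⟨(A, B), ⟨by simp [hA], by simp [hB]⟩, rfl⟩

/-- The time evolution `e^{-itH} A e^{itH}`. -/
def evolve (H : Op D Λ) (t : ℝ) (A : Op D Λ) : Op D Λ :=
  NormedSpace.exp (-((Complex.I * (t : ℂ)) • H)) * A * NormedSpace.exp ((Complex.I * (t : ℂ)) • H)

/-- `H` satisfies a Lieb-Robinson bound with decay `ζ`:
`‖[e^{-itH} A e^{itH}, B]‖ ≤ ‖A‖ ‖B‖ ζ(X, Y, |t|)` for all `A ∈ 𝒜_X`, `B ∈ 𝒜_Y`, `t ∈ ℝ`. -/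
def LiebRobinsonBound (H : Op D Λ) (ζ : Finset Λ → Finset Λ → ℝ≥0 → ℝ≥0) : Prop :=
  ∀ X Y : Finset Λ, ∀ A ∈ localAlgebra D X, ∀ B ∈ localAlgebra D Y, ∀ t : ℝ,
    ‖evolve H t A * B - B * evolve H t A‖ ≤ ‖A‖ * ‖B‖ * (ζ X Y (Real.nnabs t) : ℝ)

/-- `ζ_QBP(X,r) = min {2, inf_{T ≥ 0} ‖ζ_LR(X, Λ \ X_r, |·|)‖_{L^∞([-T,T])} + 4 e^{-πT/β}}`.
The minimum is taken in `[0,∞]`, so that an infinite `L^∞`-norm is really infinite. -/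
def zetaQBP (ζ : Finset Λ → Finset Λ → ℝ≥0 → ℝ≥0) (β : ℝ) (X : Finset Λ) (r : ℝ) : ℝ :=
  (min 2 (⨅ T : ℝ≥0,
    MeasureTheory.eLpNorm (fun t : ℝ => (ζ X (nbhd X r)ᶜ (Real.nnabs t) : ℝ)) ∞
        (MeasureTheory.volume.restrict (Set.Icc (-(T : ℝ)) (T : ℝ)))
      + ENNReal.ofReal (4 * Real.exp (-(Real.pi / β * (T : ℝ)))))).toReal

end SpinLattice

end

/-! ### Partial fractions of the hyperbolic tangent. -/

section TanhSeries

open Real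

/-! Put G(s) = e^{-βH(s)}. In an eigenbasis of H(s) the derivative of the exponential acts by
divided differences, and (e^a - e^b)/(a - b) is the mean of e^a and e^b times tanh(y/2)/(y/2), y = a
- b. This multiplier is the Fourier transform of a probability measure on time. Hence G' = -(β/2)(ΦG
+ GΦ), where Φ(s) is the average over that measure of V evolved under H(s) (quantum belief
propagation, `fderiv_exp_eq_qbpOp`). Integrating gives G(1) = η G(0) η* with ‖η‖ ≤ e^{β‖V‖/2}
(`exists_propagator`).

The measure has tails at most e^{-πT/β}, so the Lieb-Robinson bound makes Φ(s) almost commute with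
unitaries supported outside X_r (`norm_commutator_qbpOp_le`). Averaging over such unitaries produces
a nearby operator supported in X_r (`exists_local_approx`), and η is thereby close to some η_r in
𝒜_{X_r}. If X_r and Y are disjoint, η_r commutes with B, so η_r* B η_r = (η_r* η_r) B, and the
difference of expectations becomes a covariance plus controlled errors (`norm_trace_gibbs_sub_le`).

If X_r meets Y, locality is not needed: the supremum of covariances is at least 1 (`one_le_covSup`),
while the left side is at most e^{2β‖V‖}‖B‖ (`norm_trace_gibbs_sub_le_exp`). -/

theorem HasSum.of_eq {α ι : Type*} [AddCommMonoid α] [TopologicalSpace α] {f g : ι → α} {a b : α}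
    (h : HasSum f a) (hfg : ∀ i, f i = g i) (hab : a = b) : HasSum g b := by
  obtain rfl : f = g := funext hfg
  exact hab ▸ h

/-- The Mittag-Leffler expansion of the tangent. -/
theorem hasSum_odd_poles_tan {z : ℂ} (h1 : z ∈ Complex.integerComplement)
    (h2 : 2 * z ∈ Complex.integerComplement) :
    HasSum (fun k : ℕ => 1 / (2 * z - (2 * k + 1)) + 1 / (2 * z + (2 * k + 1)))
      (-(π / 2) * Complex.tan (π * z)) := by
  set F : ℕ → ℂ := fun n => 1 / (2 * z - ((n : ℂ) + 1)) + 1 / (2 * z + ((n : ℂ) + 1)) with hF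
  have hS : HasSum (fun n : ℕ => 1 / (z - ((n : ℂ) + 1)) + 1 / (z + ((n : ℂ) + 1)))
      (π * Complex.cot (π * z) - 1 / z) := by
    rw [cot_series_rep' h1]
    exact (summable_cotTerm h1).hasSum
  have hT : HasSum F (π * Complex.cot (π * (2 * z)) - 1 / (2 * z)) := by
    rw [cot_series_rep' h2]
    exact (summable_cotTerm h2).hasSum
  -- The term of index n has its poles where 2z = ±(n + 1), so odd n are the even integers. These
  -- terms are half the cotangent series at z; removing them from the series at 2z leaves the odd
  -- integers.
  have hodd : HasSum (fun k => F (2 * k + 1)) (1 / 2 * (π * Complex.cot (π * z) - 1 / z)) := by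
    refine (hS.mul_left (1 / 2 : ℂ)).of_eq (fun k => ?_) rfl
    have r1 : 2 * z - (((2 * k + 1 : ℕ) : ℂ) + 1) = 2 * (z - (k + 1)) := by push_cast; ring
    have r2 : 2 * z + (((2 * k + 1 : ℕ) : ℂ) + 1) = 2 * (z + (k + 1)) := by push_cast; ring
    rw [hF]
    simp only
    rw [r1, r2, ← one_div_mul_one_div, ← one_div_mul_one_div, mul_add]
  have heven : HasSum (fun k => F (2 * k)) (∑' k, F (2 * k)) :=
    (hT.summable.comp_injective (mul_right_injective₀ (two_ne_zero' ℕ))).hasSum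
  have htot := (HasSum.even_add_odd (f := F) heven hodd).unique hT
  have hz : z ≠ 0 := Complex.integerComplement.ne_zero h1
  have hs : Complex.sin (π * z) ≠ 0 := sin_pi_mul_ne_zero h1
  have hs2 : Complex.sin (π * (2 * z)) ≠ 0 := sin_pi_mul_ne_zero h2
  have r : (π : ℂ) * (2 * z) = 2 * (π * z) := by ring
  rw [r] at hs2 htot
  rw [Complex.sin_two_mul] at hs2
  have hc : Complex.cos (π * z) ≠ 0 := right_ne_zero_of_mul hs2
  have key : Complex.cot (2 * (π * z)) =
      (Complex.cot (π * z) - Complex.tan (π * z)) / 2 := by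
    rw [Complex.cot, Complex.cot, Complex.tan, Complex.sin_two_mul, Complex.cos_two_mul']
    field_simp
  rw [key] at htot
  refine heven.of_eq (fun k => by simp [hF]) ?_
  rw [eq_sub_of_add_eq htot]
  field_simp
  ring

/-- Three quarters of the Basel sum π²/6 come from odd integers. This is both the value of the tanh
series at 0 and the total mass of the mixture `qbpMeasure`. -/
theorem hasSum_inv_odd_sq : HasSum (fun k : ℕ => 8 / ((2 * (k : ℝ) + 1) * π) ^ 2) 1 := by
  set F : ℕ → ℝ := fun n => 1 / (n : ℝ) ^ 2 with hF
  have h : HasSum F (π ^ 2 / 6) := hasSum_zeta_two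
  have ho : HasSum (fun k => F (2 * k + 1)) (∑' k, F (2 * k + 1)) :=
    (h.summable.comp_injective
      (show Function.Injective fun k : ℕ => 2 * k + 1 from fun a b h => by simpa using h)).hasSum
  have he : HasSum (fun k => F (2 * k)) (1 / 4 * (π ^ 2 / 6)) := by
    refine (h.mul_left (1 / 4)).of_eq (fun k => ?_) rfl
    simp only [hF]
    push_cast
    rw [mul_pow, ← one_div_mul_one_div]
    norm_num
  have ht := (HasSum.even_add_odd (f := F) he ho).unique h
  refine (ho.mul_left (8 / π ^ 2)).of_eq (fun k => ?_) ?_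
  · simp only [hF]
    push_cast
    field_simp
  · rw [eq_sub_of_add_eq' ht]
    field_simp
    norm_num

/-- `tanh (y / 2) / (y / 2)` with its limit at `y = 0`. -/
noncomputable def tanhQuot (y : ℝ) : ℝ := if y = 0 then 1 else tanh (y / 2) / (y / 2)

/-- For y ≠ 0 this is the tangent expansion at z = iy/(2π), by tan(iy/2) = i tanh(y/2), rescaled by
4i/(yπ). -/
theorem hasSum_tanhQuot (y : ℝ) :
    HasSum (fun k : ℕ => 8 / (((2 * (k : ℝ) + 1) * π) ^ 2 + y ^ 2)) (tanhQuot y) := by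
  unfold tanhQuot
  split_ifs with hy
  · subst hy
    simpa using hasSum_inv_odd_sq
  have hmem : ∀ c : ℝ, c ≠ 0 → (c : ℂ) * Complex.I ∈ Complex.integerComplement := by
    rintro c hc ⟨n, hn⟩
    have := congrArg Complex.im hn
    simp at this
    exact hc this.symm
  have hpi : π ≠ 0 := pi_ne_zero
  set z : ℂ := ((y / (2 * π) : ℝ) : ℂ) * Complex.I with hz
  have e2 : 2 * z = ((y / π : ℝ) : ℂ) * Complex.I := by
    rw [hz]; push_cast; field_simp
  have h := hasSum_odd_poles_tan (z := z) (hmem _ (by positivity)) (by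
    rw [e2]; exact hmem _ (by positivity))
  have e3 : (π : ℂ) * z = ((y / 2 : ℝ) : ℂ) * Complex.I := by
    rw [hz]; push_cast; field_simp
  rw [e3, Complex.tan_mul_I] at h
  have h' := h.mul_left (4 * Complex.I / (y * π))
  have hyC : (y : ℂ) ≠ 0 := by exact_mod_cast hy
  have hpC : (π : ℂ) ≠ 0 := by exact_mod_cast hpi
  rw [← Complex.hasSum_ofReal]
  refine h'.of_eq (fun k => ?_) ?_
  · have hk : ∀ σ : ℝ, σ ≠ 0 → ((y / π : ℝ) : ℂ) * Complex.I + σ ≠ 0 := by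
      intro σ hσ h0
      have := congrArg Complex.re h0
      simp at this
      exact hσ this
    have hk1 := hk (-(2 * k + 1)) (by
      have : (0 : ℝ) < 2 * k + 1 := by positivity
      linarith)
    have hk2 := hk (2 * k + 1) (by positivity)
    rw [e2]
    push_cast at hk1 hk2 ⊢
    rw [← sub_eq_add_neg] at hk1
    have hk3 : ((2 * (k : ℂ) + 1) * π) ^ 2 + (y : ℂ) ^ 2 ≠ 0 := by
      have : (0 : ℝ) < ((2 * k + 1) * π) ^ 2 + y ^ 2 := by positivity
      exact_mod_cast this.ne'
    rw [one_div_add_one_div hk1 hk2]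
    have hprod : ((y : ℂ) / π * Complex.I - (2 * k + 1)) * ((y : ℂ) / π * Complex.I + (2 * k + 1)) =
        -((((2 * (k : ℂ) + 1) * π) ^ 2 + (y : ℂ) ^ 2) / π ^ 2) := by
      have hI : Complex.I ^ 2 = -1 := Complex.I_sq
      field_simp
      linear_combination (y : ℂ) ^ 2 * hI
    rw [hprod]
    field_simp
    rw [← neg_div]
    congr 1
    linear_combination -8 * (y : ℂ) * Complex.I_sq
  · rw [← Complex.ofReal_tanh]
    push_cast
    field_simp
    linear_combination -4 * Complex.tanh (y / 2) * Complex.I_sq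

theorem tanhQuot_zero : tanhQuot 0 = 1 := by simp [tanhQuot]

/-- Factoring e^{(a+b)/2} out of both sides leaves tanh = sinh/cosh. Writing the divided difference
with the symmetric mean is what later yields an anticommutator. -/
theorem tanhQuot_sub_mul {a b : ℝ} (hab : a ≠ b) :
    tanhQuot (a - b) * ((exp a + exp b) / 2) = (exp a - exp b) / (a - b) := by
  have h : a - b ≠ 0 := sub_ne_zero.mpr hab
  rw [tanhQuot, if_neg h, tanh_eq_sinh_div_cosh]
  have ha : exp a = exp ((a + b) / 2) * exp ((a - b) / 2) := by rw [← exp_add]; ring_nf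
  have hb : exp b = exp ((a + b) / 2) * exp (-((a - b) / 2)) := by rw [← exp_add]; ring_nf
  have hc := (cosh_pos ((a - b) / 2)).ne'
  rw [sinh_eq, cosh_eq] at *
  rw [ha, hb]
  field_simp

end TanhSeries

/-! ### The time-averaging measure and its tails. -/

section LaplaceMixture

open Real MeasureTheory

/-- The centred Laplace distribution with rate `a`. -/
noncomputable def laplaceMeasure (a : ℝ) : Measure ℝ :=
  volume.withDensity fun t => ENNReal.ofReal (a / 2 * exp (-(a * |t|)))

theorem integral_laplace_Ioi {a T : ℝ} (ha : 0 < a) :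
    ∫ t in Set.Ioi T, a / 2 * exp (-(a * t)) = exp (-(a * T)) / 2 := by
  have := integral_exp_mul_Ioi (a := -a) (by linarith) T
  simp only [neg_mul] at this
  rw [integral_const_mul, this]
  field_simp

theorem laplaceMeasure_Ioi {a T : ℝ} (ha : 0 < a) (hT : 0 ≤ T) :
    laplaceMeasure a (Set.Ioi T) = ENNReal.ofReal (exp (-(a * T)) / 2) := by
  rw [laplaceMeasure, withDensity_apply _ measurableSet_Ioi, ← integral_laplace_Ioi ha,
    ofReal_integral_eq_lintegral_ofReal]
  · refine setLIntegral_congr_fun measurableSet_Ioi fun t ht => ?_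
    rw [Set.mem_Ioi] at ht
    simp only [abs_of_pos (hT.trans_lt ht)]
  · have := integrableOn_exp_mul_Ioi (a := -a) (by linarith) T
    simp only [neg_mul] at this
    exact this.const_mul _
  · exact Filter.Eventually.of_forall fun t => by positivity

theorem laplaceMeasure_Iio_neg {a T : ℝ} :
    laplaceMeasure a (Set.Iio (-T)) = laplaceMeasure a (Set.Ioi T) := by
  rw [laplaceMeasure, withDensity_apply _ measurableSet_Iio, withDensity_apply _ measurableSet_Ioi,
    ← (Measure.measurePreserving_neg volume).setLIntegral_comp_preimage measurableSet_Ioi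
    (by fun_prop)]
  simp

theorem laplaceMeasure_compl_Icc_le {a T : ℝ} (ha : 0 < a) (hT : 0 ≤ T) :
    laplaceMeasure a (Set.Icc (-T) T)ᶜ ≤ ENNReal.ofReal (exp (-(a * T))) := by
  have hsub : (Set.Icc (-T) T)ᶜ ⊆ Set.Iio (-T) ∪ Set.Ioi T := by
    intro t ht
    rw [Set.mem_compl_iff, Set.mem_Icc, not_and_or, not_le, not_le] at ht
    exact ht
  refine (measure_mono hsub).trans ((measure_union_le _ _).trans ?_)
  rw [laplaceMeasure_Iio_neg, laplaceMeasure_Ioi ha hT,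
    ← ENNReal.ofReal_add (by positivity) (by positivity), add_halves]

theorem isProbabilityMeasure_laplaceMeasure {a : ℝ} (ha : 0 < a) :
    IsProbabilityMeasure (laplaceMeasure a) := by
  constructor
  have h0 : laplaceMeasure a {0} = 0 := withDensity_absolutelyContinuous _ _ (by simp)
  have h1 := laplaceMeasure_Ioi ha le_rfl
  have h2 := laplaceMeasure_Iio_neg (a := a) (T := 0)
  rw [neg_zero] at h2
  have hu : (Set.univ : Set ℝ) = (Set.Iio 0 ∪ Set.Ioi 0) ∪ {0} := by
    refine (Set.eq_univ_of_forall fun t => ?_).symm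
    rcases lt_trichotomy t 0 with h | h | h
    exacts [Or.inl (Or.inl h), Or.inr h, Or.inl (Or.inr h)]
  rw [hu, measure_union _ (by simp), measure_union _ measurableSet_Ioi, h2, h1, h0,
    ← ENNReal.ofReal_add (by positivity) (by positivity)]
  · rw [add_zero, add_halves, mul_zero, neg_zero, exp_zero, ENNReal.ofReal_one]
  · exact Set.disjoint_left.mpr fun t (h : t < 0) (h' : 0 < t) => absurd h h'.not_gt
  · simp

theorem integral_laplaceMeasure_exp {a : ℝ} (ha : 0 < a) (ω : ℝ) :
    ∫ t, Complex.exp (-(Complex.I * t * ω)) ∂(laplaceMeasure a) =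
      ((a ^ 2 / (a ^ 2 + ω ^ 2) : ℝ) : ℂ) := by
  rw [laplaceMeasure, integral_withDensity_eq_integral_toReal_smul (by fun_prop) (by simp)]
  have e : ∀ t : ℝ, (ENNReal.ofReal (a / 2 * exp (-(a * |t|)))).toReal •
      Complex.exp (-(Complex.I * t * ω)) =
      a / 2 * Complex.exp (-(a * |t|) - Complex.I * t * ω) := by
    intro t
    rw [ENNReal.toReal_ofReal (by positivity), Complex.real_smul]
    push_cast
    rw [mul_assoc, ← Complex.exp_add]
    ring_nf
  simp_rw [e]
  have hp : 0 < ((a : ℂ) - Complex.I * ω).re := by simpa using ha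
  have hn : (-(a : ℂ) - Complex.I * ω).re < 0 := by simpa using ha
  have c1 : Set.EqOn (fun t : ℝ => (a : ℂ) / 2 * Complex.exp (-(a * |t|) - Complex.I * t * ω))
      (fun t : ℝ => (a : ℂ) / 2 * Complex.exp (((a : ℂ) - Complex.I * ω) * t)) (Set.Iic 0) := by
    intro t ht
    simp only [abs_of_nonpos (Set.mem_Iic.mp ht)]
    push_cast
    ring_nf
  have c2 : Set.EqOn (fun t : ℝ => (a : ℂ) / 2 * Complex.exp (-(a * |t|) - Complex.I * t * ω))
      (fun t : ℝ => (a : ℂ) / 2 * Complex.exp ((-(a : ℂ) - Complex.I * ω) * t)) (Set.Ioi 0) := by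
    intro t ht
    simp only [abs_of_pos (Set.mem_Ioi.mp ht)]
    ring_nf
  rw [← intervalIntegral.integral_Iic_add_Ioi (b := 0),
    setIntegral_congr_fun measurableSet_Iic c1, setIntegral_congr_fun measurableSet_Ioi c2,
    integral_const_mul, integral_const_mul, integral_exp_mul_complex_Iic hp,
    integral_exp_mul_complex_Ioi hn]
  · have h1 : (a : ℂ) - Complex.I * ω ≠ 0 := fun h => by rw [h] at hp; simp at hp
    have h2 : -(a : ℂ) - Complex.I * ω ≠ 0 := fun h => by rw [h] at hn; simp at hn
    have h3 : (a : ℂ) ^ 2 + (ω : ℂ) ^ 2 ≠ 0 := by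
      have : 0 < a ^ 2 + ω ^ 2 := by positivity
      exact_mod_cast this.ne'
    push_cast
    simp only [mul_zero, Complex.exp_zero]
    field_simp
    linear_combination (-2 : ℂ) * (a : ℂ) ^ 2 * (ω : ℂ) ^ 2 * Complex.I_sq
  · exact IntegrableOn.congr_fun ((integrableOn_exp_mul_complex_Iic hp 0).const_mul _) c1.symm
      measurableSet_Iic
  · exact IntegrableOn.congr_fun ((integrableOn_exp_mul_complex_Ioi hn 0).const_mul _) c2.symm
      measurableSet_Ioi

/-- The mixture of Laplace distributions whose characteristic function is
`ω ↦ tanh (β ω / 2) / (β ω / 2)`. -/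
noncomputable def qbpMeasure (β : ℝ) : Measure ℝ :=
  Measure.sum fun k : ℕ =>
    ENNReal.ofReal (8 / ((2 * (k : ℝ) + 1) * π) ^ 2) • laplaceMeasure ((2 * k + 1) * π / β)

theorem tsum_qbpWeights :
    ∑' k : ℕ, ENNReal.ofReal (8 / ((2 * (k : ℝ) + 1) * π) ^ 2) = 1 := by
  rw [← ENNReal.ofReal_tsum_of_nonneg (fun k => by positivity) hasSum_inv_odd_sq.summable,
    hasSum_inv_odd_sq.tsum_eq, ENNReal.ofReal_one]

theorem isProbabilityMeasure_qbpMeasure {β : ℝ} (hβ : 0 < β) :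
    IsProbabilityMeasure (qbpMeasure β) := by
  constructor
  rw [qbpMeasure, Measure.sum_apply _ MeasurableSet.univ, ← tsum_qbpWeights]
  refine tsum_congr fun k => ?_
  have := isProbabilityMeasure_laplaceMeasure (a := (2 * (k : ℝ) + 1) * π / β) (by positivity)
  simp

theorem qbpMeasure_compl_Icc_le {β T : ℝ} (hβ : 0 < β) (hT : 0 ≤ T) :
    qbpMeasure β (Set.Icc (-T) T)ᶜ ≤ ENNReal.ofReal (exp (-(π / β * T))) := by
  rw [qbpMeasure, Measure.sum_apply _ measurableSet_Icc.compl,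
    ← one_mul (ENNReal.ofReal (exp _)), ← tsum_qbpWeights, ← ENNReal.tsum_mul_right]
  refine ENNReal.tsum_le_tsum fun k => ?_
  rw [Measure.smul_apply, smul_eq_mul]
  gcongr
  refine (laplaceMeasure_compl_Icc_le (by positivity) hT).trans (ENNReal.ofReal_le_ofReal ?_)
  refine exp_le_exp.mpr (neg_le_neg (mul_le_mul_of_nonneg_right ?_ hT))
  gcongr
  nlinarith [pi_pos, (Nat.cast_nonneg k : (0 : ℝ) ≤ k)]

/-- The rates and weights are chosen so that each Laplace characteristic function a²/(a² + ω²),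
times its weight, is one term of the tanh series. -/
theorem integral_qbpMeasure_exp {β : ℝ} (hβ : 0 < β) (ω : ℝ) :
    ∫ t, Complex.exp (-(Complex.I * t * ω)) ∂(qbpMeasure β) = (tanhQuot (β * ω) : ℂ) := by
  have := isProbabilityMeasure_qbpMeasure hβ
  have hint : Integrable (fun t : ℝ => Complex.exp (-(Complex.I * t * ω))) (qbpMeasure β) := by
    refine Integrable.of_bound (by fun_prop) 1 (Filter.Eventually.of_forall fun t => ?_)
    rw [Complex.norm_exp]
    simp
  have h := hasSum_integral_measure hint
  refine h.unique ((Complex.hasSum_ofReal.mpr (hasSum_tanhQuot (β * ω))).of_eq (fun k => ?_) rfl)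
  rw [integral_smul_measure, integral_laplaceMeasure_exp (by positivity),
    ENNReal.toReal_ofReal (by positivity), Complex.real_smul, ← Complex.ofReal_mul]
  congr 1
  field_simp

/-- Needed because the Lieb-Robinson function enters only through its Lebesgue essential supremum.
-/
theorem qbpMeasure_absolutelyContinuous (β : ℝ) : qbpMeasure β ≪ volume :=
  Measure.absolutelyContinuous_sum_left fun _ =>
    (Measure.AbsolutelyContinuous.smul_left (withDensity_absolutelyContinuous _ _) _)

end LaplaceMixture

/-! ### The derivative of the matrix exponential on eigenvectors. -/

section ExpDerivative

open NormedSpace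

theorem tanhQuot_neg (y : ℝ) : tanhQuot (-y) = tanhQuot y := by
  unfold tanhQuot
  rw [neg_div, Real.tanh_neg, neg_div_neg_eq]
  simp only [neg_eq_zero]

variable {n : Type*} [Fintype n] [DecidableEq n]

theorem exp_mul_of_mul_eq_smul {A B : Matrix n n ℂ} {a : ℂ} (h : A * B = a • B) :
    exp A * B = Complex.exp a • B := by
  have hpow : ∀ k : ℕ, A ^ k * B = a ^ k • B := by
    intro k
    induction k with
    | zero => simp
    | succ k ih => rw [pow_succ, mul_assoc, h, mul_smul_comm, ih, smul_smul, pow_succ']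
  have h1 := (exp_series_hasSum_exp' (𝕂 := ℂ) A).mul_right B
  have h2 := (exp_series_hasSum_exp' (𝕂 := ℂ) a).smul_const B
  rw [← Complex.exp_eq_exp_ℂ] at h2
  refine h1.unique (h2.of_eq (fun k => ?_) rfl)
  rw [smul_mul_assoc, hpow, smul_assoc]

theorem mul_exp_of_mul_eq_smul {A B : Matrix n n ℂ} {b : ℂ} (h : B * A = b • B) :
    B * exp A = Complex.exp b • B := by
  have hpow : ∀ k : ℕ, B * A ^ k = b ^ k • B := by
    intro k
    induction k with
    | zero => simp
    | succ k ih => rw [pow_succ', ← mul_assoc, h, smul_mul_assoc, ih, smul_smul, pow_succ']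
  have h1 := (exp_series_hasSum_exp' (𝕂 := ℂ) A).mul_left B
  have h2 := (exp_series_hasSum_exp' (𝕂 := ℂ) b).smul_const B
  rw [← Complex.exp_eq_exp_ℂ] at h2
  refine h1.unique (h2.of_eq (fun k => ?_) rfl)
  rw [mul_smul_comm, hpow, smul_assoc]

theorem hasFDerivAt_exp_matrix (A : Matrix n n ℂ) :
    HasFDerivAt (𝕜 := ℂ) exp (fderiv ℂ exp A) A :=
  (exp_analytic (𝕂 := ℂ) A).differentiableAt.hasFDerivAt

theorem hasDerivAt_exp_add_smul (A B : Matrix n n ℂ) :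
    HasDerivAt (fun δ : ℂ => exp (A + δ • B)) (fderiv ℂ exp A B) 0 := by
  have h1 : HasDerivAt (fun δ : ℂ => A + δ • B) B 0 := by
    simpa using ((hasDerivAt_id (0 : ℂ)).smul_const B).const_add A
  have h2 := hasFDerivAt_exp_matrix (A + (0 : ℂ) • B)
  have h3 := h2.comp_hasDerivAt (0 : ℂ) h1
  rw [zero_smul, add_zero] at h3
  exact h3

/-- The derivative of the matrix exponential in the direction of an eigenvector of the commutator
map. -/
theorem fderiv_exp_apply_of_eigen {A B : Matrix n n ℂ} {a b : ℝ} (h1 : A * B = (a : ℂ) • B)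
    (h2 : B * A = (b : ℂ) • B) :
    fderiv ℂ exp A B = ((tanhQuot (a - b) * ((Real.exp a + Real.exp b) / 2) : ℝ) : ℂ) • B := by
  refine (hasDerivAt_exp_add_smul A B).unique ?_
  rcases eq_or_ne a b with rfl | hab
  · have hcomm : Commute A B := h1.trans h2.symm
    have hexp : ∀ δ : ℂ, exp (A + δ • B) = exp A * exp (δ • B) := fun δ =>
      Matrix.exp_add_of_commute _ _ (hcomm.smul_right δ)
    simp_rw [hexp]
    have h := (hasDerivAt_exp_smul_const (𝕂 := ℂ) B (0 : ℂ)).const_mul (exp A)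
    rw [zero_smul, exp_zero, one_mul, exp_mul_of_mul_eq_smul h1] at h
    rw [sub_self, tanhQuot_zero, one_mul, add_self_div_two, Complex.ofReal_exp]
    exact h
  · have hd : ((a : ℂ) - b) ≠ 0 := by
      rw [← Complex.ofReal_sub]; exact_mod_cast sub_ne_zero.mpr hab
    -- For a ≠ b the eigenvector squares to zero. Then A + δB is the conjugate of A by 1 - δB/(a -
    -- b), so its exponential is exactly affine in δ.
    have hBB : B * B = 0 := by
      have e1 : B * A * B = (a : ℂ) • (B * B) := by rw [mul_assoc, h1, mul_smul_comm]
      have e2 : B * A * B = (b : ℂ) • (B * B) := by rw [h2, smul_mul_assoc]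
      have e3 : ((a : ℂ) - b) • (B * B) = 0 := by rw [sub_smul, ← e1, ← e2, sub_self]
      exact (smul_eq_zero.mp e3).resolve_left hd
    set c : ℂ := ((a : ℂ) - b)⁻¹ with hc
    have hinv : ∀ z : ℂ, (1 - z • B) * (1 + z • B) = 1 := fun z => by
      simp [sub_mul, mul_add, hBB]
    have hconj : ∀ (M : Matrix n n ℂ) (u v : ℂ), M * B = u • B → B * M = v • B → ∀ z : ℂ,
        (1 - z • B) * M * (1 + z • B) = M + (z * (u - v)) • B := by
      intro M u v hu hv z
      have hBMB : B * M * B = 0 := by rw [hv, smul_mul_assoc, hBB, smul_zero]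
      simp only [sub_mul, mul_add, one_mul, mul_one, smul_mul_assoc, mul_smul_comm, hu, hv, hBB,
        smul_zero]
      module
    have hexp : ∀ δ : ℂ, exp (A + δ • B) =
        exp A + (δ * c * (Complex.exp a - Complex.exp b)) • B := by
      intro δ
      have hinv' : (1 + (δ * c) • B) * (1 - (δ * c) • B) = 1 := by
        simpa [sub_eq_add_neg] using hinv (-(δ * c))
      let U : (Matrix n n ℂ)ˣ := ⟨1 - (δ * c) • B, 1 + (δ * c) • B, hinv _, hinv'⟩
      have hA : A + δ • B = U * A * (U⁻¹ : (Matrix n n ℂ)ˣ) := by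
        have := hconj A a b h1 h2 (δ * c)
        rw [mul_assoc δ, hc, inv_mul_cancel₀ hd, mul_one] at this
        exact this.symm
      rw [hA, Matrix.exp_units_conj]
      exact hconj _ _ _ (exp_mul_of_mul_eq_smul h1) (mul_exp_of_mul_eq_smul h2) (δ * c)
    simp_rw [hexp]
    rw [tanhQuot_sub_mul hab]
    have h := ((((hasDerivAt_id (0 : ℂ)).mul_const c).mul_const
      (Complex.exp a - Complex.exp b)).smul_const B).const_add (exp A)
    convert h using 1
    congr 1
    push_cast
    rw [hc]
    simp only [one_mul]
    field_simp

theorem Matrix.IsHermitian.exists_diagonalization {H : Matrix n n ℂ} (hH : H.IsHermitian) :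
    ∃ (U : Matrix n n ℂ) (e : n → ℝ), star U * U = 1 ∧ U * star U = 1 ∧
      H = U * Matrix.diagonal (fun i => (e i : ℂ)) * star U := by
  refine ⟨hH.eigenvectorUnitary.1, hH.eigenvalues, Unitary.coe_star_mul_self _,
    Unitary.coe_mul_star_self _, ?_⟩
  conv_lhs => rw [hH.spectral_theorem, Unitary.conjStarAlgAut_apply]
  rfl

theorem Matrix.diagonal_mul_single' (d : n → ℂ) (i j : n) (x : ℂ) :
    Matrix.diagonal d * Matrix.single i j x = d i • Matrix.single i j x := by
  ext k l
  rw [Matrix.diagonal_mul, Matrix.smul_apply, smul_eq_mul, Matrix.single_apply]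
  split_ifs with h
  · rw [h.1]
  · simp

theorem Matrix.single_mul_diagonal' (d : n → ℂ) (i j : n) (x : ℂ) :
    Matrix.single i j x * Matrix.diagonal d = d j • Matrix.single i j x := by
  ext k l
  rw [Matrix.mul_diagonal, Matrix.smul_apply, smul_eq_mul, Matrix.single_apply, mul_comm]
  split_ifs with h
  · rw [h.2]
  · simp

/-- The eigenvectors of the left and right multiplication by a Hermitian matrix span. -/
theorem Matrix.IsHermitian.induction_eigen {H : Matrix n n ℂ} (hH : H.IsHermitian)
    {P : Matrix n n ℂ → Prop} (hadd : ∀ A B, P A → P B → P (A + B))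
    (heig : ∀ (a b : ℝ) (B : Matrix n n ℂ), H * B = (a : ℂ) • B → B * H = (b : ℂ) • B → P B)
    (V : Matrix n n ℂ) : P V := by
  obtain ⟨U, e, hUU, hUU', hs⟩ := hH.exists_diagonalization
  suffices h : ∀ W : Matrix n n ℂ, P (U * W * star U) by
    have := h (star U * V * U)
    rwa [show U * (star U * V * U) * star U = (U * star U) * V * (U * star U) by noncomm_ring,
      hUU', one_mul, mul_one] at this
  intro W
  induction W using Matrix.induction_on' with
  | h_zero => exact heig 0 0 _ (by simp) (by simp)
  | h_add p q hp hq => rw [mul_add, add_mul]; exact hadd _ _ hp hq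
  | h_std_basis i j x =>
    refine heig (e i) (e j) _ ?_ ?_
    · rw [hs, show ∀ D S : Matrix n n ℂ, U * D * star U * (U * S * star U) =
        U * (D * (star U * U) * S) * star U by intros; noncomm_ring, hUU, mul_one,
        Matrix.diagonal_mul_single', mul_smul_comm, smul_mul_assoc]
    · rw [hs, show ∀ D S : Matrix n n ℂ, U * S * star U * (U * D * star U) =
        U * (S * (star U * U) * D) * star U by intros; noncomm_ring, hUU, mul_one,
        Matrix.single_mul_diagonal', mul_smul_comm, smul_mul_assoc]

end ExpDerivative

/-! ### Quantum belief propagation. -/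

namespace SpinLattice

open MeasureTheory

variable {ν D : ℕ} {Λ : Finset (Fin ν → ℤ)}

theorem exp_smul_I_mem_unitary {H : Op D Λ} (hH : IsSelfAdjoint H) (t : ℝ) :
    NormedSpace.exp ((Complex.I * (t : ℂ)) • H) ∈ unitary (Op D Λ) := by
  let : NormedAlgebra ℚ (Op D Λ) := NormedAlgebra.restrictScalars ℚ ℂ _
  refine NormedSpace.exp_mem_unitary_of_mem_skewAdjoint ?_
  rw [skewAdjoint.mem_iff, star_smul, hH.star_eq]
  simp

theorem norm_evolve {H : Op D Λ} (hH : IsSelfAdjoint H) (t : ℝ) (A : Op D Λ) :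
    ‖evolve H t A‖ = ‖A‖ := by
  have h1 := exp_smul_I_mem_unitary hH (-t)
  rw [Complex.ofReal_neg, mul_neg, neg_smul] at h1
  rw [evolve, CStarRing.norm_mul_mem_unitary _ (exp_smul_I_mem_unitary hH t),
    CStarRing.norm_mem_unitary_mul _ h1]

theorem continuous_evolve (H A : Op D Λ) : Continuous fun t : ℝ => evolve H t A := by
  let : NormedAlgebra ℚ (Op D Λ) := NormedAlgebra.restrictScalars ℚ ℂ _
  have h : Continuous (NormedSpace.exp : Op D Λ → Op D Λ) := NormedSpace.exp_continuous
  unfold evolve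
  fun_prop

theorem integrable_evolve {H : Op D Λ} (hH : IsSelfAdjoint H) (A : Op D Λ) (μ : Measure ℝ)
    [IsFiniteMeasure μ] : Integrable (fun t : ℝ => evolve H t A) μ :=
  Integrable.of_bound (continuous_evolve H A).aestronglyMeasurable ‖A‖
    (Filter.Eventually.of_forall fun t => (norm_evolve hH t A).le)

/-- The quantum belief propagation operator `∫ f_β(t) e^{-itH} V e^{itH} dt`. -/
noncomputable def qbpOp (β : ℝ) (H V : Op D Λ) : Op D Λ := ∫ t, evolve H t V ∂(qbpMeasure β)

theorem norm_qbpOp_le {β : ℝ} (hβ : 0 < β) {H : Op D Λ} (hH : IsSelfAdjoint H) (V : Op D Λ) :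
    ‖qbpOp β H V‖ ≤ ‖V‖ := by
  have := isProbabilityMeasure_qbpMeasure hβ
  have h := norm_integral_le_of_norm_le_const (μ := qbpMeasure β)
    (Filter.Eventually.of_forall fun t => (norm_evolve hH t V).le)
  rw [probReal_univ, mul_one] at h
  exact h

theorem qbpOp_add {β : ℝ} (hβ : 0 < β) {H : Op D Λ} (hH : IsSelfAdjoint H) (V W : Op D Λ) :
    qbpOp β H (V + W) = qbpOp β H V + qbpOp β H W := by
  have := isProbabilityMeasure_qbpMeasure hβ
  rw [qbpOp, qbpOp, qbpOp, ← integral_add (integrable_evolve hH V _) (integrable_evolve hH W _)]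
  simp [evolve, mul_add, add_mul]

/-- On an eigenvector the evolution is the phase e^{-it(a-b)}, so averaging evaluates the Fourier
transform of the measure. -/
theorem qbpOp_of_eigen {β : ℝ} (hβ : 0 < β) {H B : Op D Λ} {a b : ℝ}
    (h1 : H * B = (a : ℂ) • B) (h2 : B * H = (b : ℂ) • B) :
    qbpOp β H B = (tanhQuot (β * (a - b)) : ℂ) • B := by
  have h : ∀ t : ℝ, evolve H t B = Complex.exp (-(Complex.I * t * ((a - b : ℝ) : ℂ))) • B := by
    intro t
    have e1 : -((Complex.I * (t : ℂ)) • H) * B = (-(Complex.I * t * a)) • B := by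
      rw [neg_mul, smul_mul_assoc, h1, smul_smul, neg_smul]
    have e2 : B * ((Complex.I * (t : ℂ)) • H) = (Complex.I * t * b) • B := by
      rw [mul_smul_comm, h2, smul_smul]
    rw [evolve, exp_mul_of_mul_eq_smul e1, smul_mul_assoc, mul_exp_of_mul_eq_smul e2, smul_smul,
      ← Complex.exp_add]
    congr 2
    push_cast
    ring
  simp_rw [qbpOp, h]
  rw [integral_smul_const, integral_qbpMeasure_exp hβ]

/-- Both sides are additive in V, so eigenvectors suffice. There both are multiples of B: the left
by the divided difference at -βa and -βb, the right by `tanhQuot` times the mean of the two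
exponentials. -/
theorem fderiv_exp_eq_qbpOp {β : ℝ} (hβ : 0 < β) {H : Op D Λ} (hH : IsSelfAdjoint H) (V : Op D Λ) :
    fderiv ℂ NormedSpace.exp (-(β • H)) V = (1 / 2 : ℂ) •
      (qbpOp β H V * NormedSpace.exp (-(β • H)) + NormedSpace.exp (-(β • H)) * qbpOp β H V) := by
  have hH' : Matrix.IsHermitian H := hH
  refine hH'.induction_eigen (P := fun V => fderiv ℂ NormedSpace.exp (-(β • H)) V = (1 / 2 : ℂ) •
      (qbpOp β H V * NormedSpace.exp (-(β • H)) + NormedSpace.exp (-(β • H)) * qbpOp β H V))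
    ?_ ?_ V
  · intro A B hA hB
    simp only [map_add, hA, hB, qbpOp_add hβ hH, add_mul, mul_add]
    module
  · intro a b B h1 h2
    have e1 : -(β • H) * B = ((-(β * a) : ℝ) : ℂ) • B := by
      rw [neg_mul, smul_mul_assoc, h1, ← Complex.coe_smul, smul_smul, ← neg_smul]
      push_cast
      rfl
    have e2 : B * -(β • H) = ((-(β * b) : ℝ) : ℂ) • B := by
      rw [mul_neg, mul_smul_comm, h2, ← Complex.coe_smul, smul_smul, ← neg_smul]
      push_cast
      rfl
    rw [fderiv_exp_apply_of_eigen e1 e2, qbpOp_of_eigen hβ h1 h2, smul_mul_assoc, mul_smul_comm,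
      exp_mul_of_mul_eq_smul e1, mul_exp_of_mul_eq_smul e2,
      show -(β * a) - -(β * b) = -(β * (a - b)) by ring, tanhQuot_neg, smul_smul, smul_smul,
      ← add_smul, smul_smul]
    congr 1
    push_cast
    ring

/-- The unnormalised Gibbs state along the segment from `H` to `H + V`. -/
noncomputable def expSegment (β : ℝ) (H V : Op D Λ) (s : ℝ) : Op D Λ :=
  NormedSpace.exp (-(β • (H + s • V)))

/-- Provides continuity of the derivative of the segment directly, without proving that the averaged
operator is continuous in s. -/
theorem contDiff_expSegment (β : ℝ) (H V : Op D Λ) : ContDiff ℝ 1 (expSegment β H V) := by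
  have h : ContDiff ℝ 1 (NormedSpace.exp : Op D Λ → Op D Λ) :=
    contDiff_iff_contDiffAt.mpr fun A => (NormedSpace.exp_analytic (𝕂 := ℝ) A).contDiffAt
  exact h.comp (by fun_prop)

theorem isSelfAdjoint_segment {H V : Op D Λ} (hH : IsSelfAdjoint H) (hV : IsSelfAdjoint V)
    (s : ℝ) : IsSelfAdjoint (H + s • V) :=
  hH.add ((IsSelfAdjoint.all s).smul hV)

theorem hasDerivAt_expSegment {β : ℝ} (hβ : 0 < β) {H V : Op D Λ} (hH : IsSelfAdjoint H)
    (hV : IsSelfAdjoint V) (s : ℝ) :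
    HasDerivAt (expSegment β H V)
      (-(β / 2) • (qbpOp β (H + s • V) V * expSegment β H V s +
        expSegment β H V s * qbpOp β (H + s • V) V)) s := by
  have h1 : HasDerivAt (fun s : ℝ => -(β • (H + s • V))) (-(β • V)) s := by
    have := ((((hasDerivAt_id' s).smul_const V).const_add H).fun_const_smul β).fun_neg
    rwa [one_smul] at this
  have h2 := (hasFDerivAt_exp_matrix (-(β • (H + s • V)))).restrictScalars ℝ
  have h3 := h2.comp_hasDerivAt s h1
  refine h3.congr_deriv ?_
  symm
  rw [ContinuousLinearMap.coe_restrictScalars', ← neg_smul, ← neg_smul, ← Complex.coe_smul,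
    ← Complex.coe_smul (-β) V, map_smul, neg_smul β,
    fderiv_exp_eq_qbpOp hβ (isSelfAdjoint_segment hH hV s) V, smul_smul]
  change _ = _ • (_ * expSegment β H V s + expSegment β H V s * _)
  congr 1
  push_cast
  ring

end SpinLattice

/-! ### Solving G' = -c(ΦG + GΦ) by products of Euler steps. -/

section Propagator

open Set

/-- First-order Taylor expansion, uniform along equidistant partitions of the unit interval. -/
theorem exists_uniform_taylor {E : Type*} [NormedAddCommGroup E] [NormedSpace ℝ E]
    {G G' : ℝ → E} (hG : ∀ s, HasDerivAt G (G' s) s) (hG' : Continuous G') {ε : ℝ} (hε : 0 < ε) :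
    ∃ N₀ : ℕ, ∀ N : ℕ, N₀ ≤ N → ∀ k : ℕ, k < N →
      ‖G ((k + 1 : ℕ) / N) - G (k / N) - (1 / N : ℝ) • G' (k / N)‖ ≤ ε / N := by
  have hu := isCompact_Icc.uniformContinuousOn_of_continuous
    (s := Icc (0 : ℝ) 1) hG'.continuousOn
  obtain ⟨δ, hδ, hu⟩ := Metric.uniformContinuousOn_iff_le.mp hu ε hε
  obtain ⟨N₀, hN₀⟩ := exists_nat_gt (1 / δ)
  refine ⟨N₀, fun N hN k hk => ?_⟩
  have hNpos : (0 : ℝ) < N := by exact_mod_cast (Nat.zero_le k).trans_lt hk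
  have hNδ : 1 / (N : ℝ) ≤ δ := by
    rw [div_le_iff₀ hNpos, ← div_le_iff₀' hδ]
    exact hN₀.le.trans (by exact_mod_cast hN)
  have hk1 : ((k + 1 : ℕ) : ℝ) / N = k / N + 1 / N := by push_cast; ring
  have hle : ((k + 1 : ℕ) : ℝ) / N ≤ 1 := by
    rw [div_le_one hNpos]; exact_mod_cast hk
  have h0 : (0 : ℝ) ≤ k / N := by positivity
  have hN1 : 0 < 1 / (N : ℝ) := by positivity
  have hd : ∀ u ∈ Icc ((k : ℝ) / N) ((k + 1 : ℕ) / N),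
      HasDerivWithinAt (fun u => G u - u • G' (k / N)) (G' u - G' (k / N))
        (Icc ((k : ℝ) / N) ((k + 1 : ℕ) / N)) u := fun u _ => by
    have h2 := ((hasDerivAt_id' u).smul_const (G' (k / N)))
    rw [one_smul] at h2
    exact ((hG u).sub h2).hasDerivWithinAt
  have hb : ∀ u ∈ Icc ((k : ℝ) / N) ((k + 1 : ℕ) / N), ‖G' u - G' (k / N)‖ ≤ ε := by
    intro u hu'
    rw [← dist_eq_norm]
    refine hu u ⟨h0.trans hu'.1, hu'.2.trans hle⟩ _ ⟨h0, by linarith⟩ ?_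
    rw [Real.dist_eq, abs_of_nonneg (sub_nonneg.mpr hu'.1)]
    linarith [hu'.2]
  have h := (convex_Icc ((k : ℝ) / N) ((k + 1 : ℕ) / N)).norm_image_sub_le_of_norm_hasDerivWithin_le
    hd hb (left_mem_Icc.mpr (by linarith)) (right_mem_Icc.mpr (by linarith))
  rw [hk1] at h ⊢
  rw [add_sub_cancel_left, Real.norm_of_nonneg hN1.le, mul_one_div, add_smul] at h
  convert h using 2
  abel

theorem norm_one_sub_smul_le {𝔸 : Type*} [NormedRing 𝔸] [NormedAlgebra ℂ 𝔸] [NormOneClass 𝔸]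
    {A : 𝔸} {h v : ℝ} (hh : 0 ≤ h) (hA : ‖A‖ ≤ v) :
    ‖1 - h • A‖ ≤ Real.exp (h * v) := by
  refine (norm_sub_le _ _).trans ?_
  rw [norm_one, norm_smul, Real.norm_of_nonneg hh]
  have := Real.add_one_le_exp (h * v)
  have := mul_le_mul_of_nonneg_left hA hh
  linarith

variable {𝔸 : Type*} [NormedRing 𝔸] [StarRing 𝔸] [CStarRing 𝔸] [NormedAlgebra ℂ 𝔸]
  [StarModule ℂ 𝔸] [NormOneClass 𝔸]

/-- A step of length 1/N conjugates G by 1 - (c/N)Φ, up to errors of lower order. Multiplying these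
factors gives η; the same product with Ψ stays in S, and telescoping bounds the difference by c κ
e^{cv}. Only the derivative of G has to be continuous, not Φ or Ψ. -/
theorem exists_approx_propagator (S : Subalgebra ℂ 𝔸) {G Φ Ψ : ℝ → 𝔸} {c v κ : ℝ} (hc : 0 ≤ c)
    (hv : 0 ≤ v) (hκ : 0 ≤ κ) (hΦ : ∀ s, IsSelfAdjoint (Φ s))
    (hG : ∀ s, HasDerivAt G (-c • (Φ s * G s + G s * Φ s)) s)
    (hG' : Continuous fun s => -c • (Φ s * G s + G s * Φ s))
    (hΨS : ∀ s ∈ Icc (0 : ℝ) 1, Ψ s ∈ S) (hΦv : ∀ s ∈ Icc (0 : ℝ) 1, ‖Φ s‖ ≤ v)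
    (hΨv : ∀ s ∈ Icc (0 : ℝ) 1, ‖Ψ s‖ ≤ v) (hΦΨ : ∀ s ∈ Icc (0 : ℝ) 1, ‖Φ s - Ψ s‖ ≤ κ)
    {ε : ℝ} (hε : 0 < ε) :
    ∃ η ηr : 𝔸, ηr ∈ S ∧ ‖η‖ ≤ Real.exp (c * v) ∧ ‖ηr‖ ≤ Real.exp (c * v) ∧
      ‖η - ηr‖ ≤ c * κ * Real.exp (c * v) ∧ ‖G 1 - η * G 0 * star η‖ ≤ ε := by
  -- A one-step error is later conjugated by the remaining factors and grows by at most E²; hence δ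
  -- = ε/E².
  set E := Real.exp (c * v) with hE
  have hEpos : 0 < E := Real.exp_pos _
  set δ := ε / (E * E) with hδ
  have hδpos : 0 < δ := by positivity
  obtain ⟨M, hM⟩ := isCompact_Icc.exists_bound_of_continuousOn (s := Icc (0 : ℝ) 1)
    (f := G) (fun s _ => (hG s).continuousAt.continuousWithinAt)
  have hM0 : 0 ≤ M := (norm_nonneg _).trans (hM 0 (by simp))
  obtain ⟨N₀, hN₀⟩ := exists_uniform_taylor hG hG' (half_pos hδpos)
  -- With this N₁ the second-order term (c/N)² ΦGΦ of each step is at most δ/(2N); the Taylor error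
  -- takes the other half.
  obtain ⟨N₁, hN₁⟩ := exists_nat_gt (2 * (c * c * (v * M * v)) / δ)
  set N := max N₀ (N₁ + 1) with hN
  have hNpos : (0 : ℝ) < N := by
    have : 0 < N := by omega
    exact_mod_cast this
  have hN1 : (N₁ : ℝ) ≤ N := by
    have : N₁ ≤ N := by omega
    exact_mod_cast this
  set q := c / N * v with hq
  have hmem : ∀ k : ℕ, k < N → (k : ℝ) / N ∈ Icc (0 : ℝ) 1 := fun k hk =>
    ⟨by positivity, (div_le_one hNpos).mpr (by exact_mod_cast hk.le)⟩
  have hcN : 0 ≤ c / N := by positivity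
  have hlocal : ∀ k : ℕ, k < N → ‖G ((k + 1 : ℕ) / N) -
      (1 - (c / N) • Φ (k / N)) * G (k / N) * star (1 - (c / N) • Φ (k / N))‖ ≤ δ / N := by
    intro k hk
    have h1 := hN₀ N (le_max_left _ _) k hk
    have hs : star (1 - (c / N) • Φ (k / N)) = 1 - (c / N) • Φ (k / N) := by
      rw [star_sub, star_one, star_smul, star_trivial, (hΦ _).star_eq]
    have e : G ((k + 1 : ℕ) / N) -
        (1 - (c / N) • Φ (k / N)) * G (k / N) * star (1 - (c / N) • Φ (k / N)) =
        (G ((k + 1 : ℕ) / N) - G (k / N) - (1 / N : ℝ) • -c • (Φ (k / N) * G (k / N) +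
          G (k / N) * Φ (k / N))) - (c / N * (c / N)) • (Φ (k / N) * G (k / N) * Φ (k / N)) := by
      rw [hs]
      simp only [sub_mul, mul_sub, one_mul, mul_one, smul_mul_assoc, mul_smul_comm, smul_smul,
        smul_sub, smul_add]
      have : (1 / N : ℝ) * -c = -(c / N) := by ring
      rw [this]
      module
    have h2 : ‖(c / N * (c / N)) • (Φ (k / N) * G (k / N) * Φ (k / N))‖ ≤ δ / 2 / N := by
      rw [norm_smul, Real.norm_of_nonneg (by positivity)]
      have h3 : ‖Φ (k / N) * G (k / N) * Φ (k / N)‖ ≤ v * M * v := by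
        refine (norm_mul_le _ _).trans (mul_le_mul ((norm_mul_le _ _).trans (mul_le_mul
          (hΦv _ (hmem k hk)) (hM _ (hmem k hk)) (norm_nonneg _) hv)) (hΦv _ (hmem k hk))
          (norm_nonneg _) (by positivity))
      have h4 : 2 * (c * c * (v * M * v)) ≤ δ * N := by
        rw [← div_le_iff₀' hδpos]
        exact hN₁.le.trans hN1
      calc c / N * (c / N) * ‖Φ (k / N) * G (k / N) * Φ (k / N)‖
          ≤ c / N * (c / N) * (v * M * v) := by gcongr
        _ = (2 * (c * c * (v * M * v))) / (2 * N * N) := by field_simp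
        _ ≤ (δ * N) / (2 * N * N) := by gcongr
        _ = δ / 2 / N := by field_simp
    rw [e]
    refine (norm_sub_le _ _).trans ((add_le_add h1 h2).trans_eq ?_)
    field_simp
    norm_num
  have hind : ∀ k : ℕ, k ≤ N → ∃ η ηr : 𝔸, ηr ∈ S ∧ ‖η‖ ≤ Real.exp (k * q) ∧
      ‖ηr‖ ≤ Real.exp (k * q) ∧ ‖η - ηr‖ ≤ k * (c / N * κ) * Real.exp (k * q) ∧
      ‖G (k / N) - η * G 0 * star η‖ ≤ k * (δ / N) * (Real.exp (k * q) * Real.exp (k * q)) := by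
    intro k
    induction k with
    | zero => exact fun _ => ⟨1, 1, one_mem _, by simp⟩
    | succ k ih =>
      intro hk
      obtain ⟨η, ηr, hS, h1, h2, h3, h4⟩ := ih (by omega)
      have hm := hmem k hk
      set L := 1 - (c / N) • Φ (k / N) with hL
      set Lr := 1 - (c / N) • Ψ (k / N) with hLr
      have hLn : ‖L‖ ≤ Real.exp q := norm_one_sub_smul_le hcN (hΦv _ hm)
      have hLrn : ‖Lr‖ ≤ Real.exp q := norm_one_sub_smul_le hcN (hΨv _ hm)
      have hLS : Lr ∈ S := by
        refine sub_mem (one_mem _) ?_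
        rw [← Complex.coe_smul]
        exact S.smul_mem (hΨS _ hm) _
      have hLL : ‖L - Lr‖ ≤ c / N * κ := by
        have : L - Lr = -((c / N) • (Φ (k / N) - Ψ (k / N))) := by
          rw [hL, hLr, smul_sub]; abel
        rw [this, norm_neg, norm_smul, Real.norm_of_nonneg hcN]
        exact mul_le_mul_of_nonneg_left (hΦΨ _ hm) hcN
      have hexp : Real.exp ((k + 1 : ℕ) * q) = Real.exp q * Real.exp (k * q) := by
        rw [← Real.exp_add]; push_cast; ring_nf
      have hq1 : 1 ≤ Real.exp q := Real.one_le_exp (by positivity)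
      have hE1 : 1 ≤ Real.exp (k * q) := Real.one_le_exp (by positivity)
      have hck : 0 ≤ c / N * κ := by positivity
      refine ⟨L * η, Lr * ηr, mul_mem hLS hS, ?_, ?_, ?_, ?_⟩
      · rw [hexp]
        exact (norm_mul_le _ _).trans (mul_le_mul hLn h1 (norm_nonneg _) (by positivity))
      · rw [hexp]
        exact (norm_mul_le _ _).trans (mul_le_mul hLrn h2 (norm_nonneg _) (by positivity))
      · have : L * η - Lr * ηr = (L - Lr) * η + Lr * (η - ηr) := by noncomm_ring
        rw [this, hexp]
        calc ‖(L - Lr) * η + Lr * (η - ηr)‖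
            ≤ ‖L - Lr‖ * ‖η‖ + ‖Lr‖ * ‖η - ηr‖ :=
              (norm_add_le _ _).trans (add_le_add (norm_mul_le _ _) (norm_mul_le _ _))
          _ ≤ (c / N * κ) * (Real.exp q * Real.exp (k * q)) +
              Real.exp q * (k * (c / N * κ) * Real.exp (k * q)) := by
              gcongr
              exact h1.trans (le_mul_of_one_le_left (Real.exp_pos _).le hq1)
          _ = _ := by push_cast; ring
      · have : G ((k + 1 : ℕ) / N) - L * η * G 0 * star (L * η) =
            (G ((k + 1 : ℕ) / N) - L * G (k / N) * star L) +
              L * (G (k / N) - η * G 0 * star η) * star L := by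
          rw [star_mul]; noncomm_ring
        rw [this, hexp]
        calc _ ≤ ‖G ((k + 1 : ℕ) / N) - L * G (k / N) * star L‖ +
              ‖L‖ * ‖G (k / N) - η * G 0 * star η‖ * ‖star L‖ :=
              (norm_add_le _ _).trans (add_le_add le_rfl ((norm_mul_le _ _).trans
                (mul_le_mul_of_nonneg_right (norm_mul_le _ _) (norm_nonneg _))))
          _ ≤ δ / N * ((Real.exp q * Real.exp (k * q)) * (Real.exp q * Real.exp (k * q))) +
              Real.exp q * (k * (δ / N) * (Real.exp (k * q) * Real.exp (k * q))) * Real.exp q := by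
              rw [norm_star]
              gcongr
              refine (hlocal k hk).trans (le_mul_of_one_le_right (by positivity) ?_)
              have := one_le_mul_of_one_le_of_one_le hq1 hE1
              exact one_le_mul_of_one_le_of_one_le this this
          _ = _ := by push_cast; ring
  obtain ⟨η, ηr, hS, h1, h2, h3, h4⟩ := hind N le_rfl
  have e1 : (N : ℝ) * q = c * v := by rw [hq]; field_simp
  have e2 : (N : ℝ) * (c / N * κ) = c * κ := by field_simp
  have e3 : (N : ℝ) * (δ / N) * (E * E) = ε := by rw [hδ]; field_simp
  rw [e1] at h1 h2 h3 h4
  rw [e2] at h3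
  rw [div_self hNpos.ne', ← hE, e3] at h4
  exact ⟨η, ηr, hS, h1, h2, h3, h4⟩

/-- The constraints on (η, η_r) cut out a compact set, so the residual attains its minimum there.
The minimum lies below every ε > 0, hence is 0. -/
theorem exists_propagator [FiniteDimensional ℂ 𝔸] (S : Subalgebra ℂ 𝔸) {G Φ Ψ : ℝ → 𝔸}
    {c v κ : ℝ} (hc : 0 ≤ c) (hv : 0 ≤ v) (hκ : 0 ≤ κ) (hΦ : ∀ s, IsSelfAdjoint (Φ s))
    (hG : ∀ s, HasDerivAt G (-c • (Φ s * G s + G s * Φ s)) s)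
    (hG' : Continuous fun s => -c • (Φ s * G s + G s * Φ s))
    (hΨS : ∀ s ∈ Icc (0 : ℝ) 1, Ψ s ∈ S) (hΦv : ∀ s ∈ Icc (0 : ℝ) 1, ‖Φ s‖ ≤ v)
    (hΨv : ∀ s ∈ Icc (0 : ℝ) 1, ‖Ψ s‖ ≤ v) (hΦΨ : ∀ s ∈ Icc (0 : ℝ) 1, ‖Φ s - Ψ s‖ ≤ κ) :
    ∃ η ηr : 𝔸, ηr ∈ S ∧ ‖η‖ ≤ Real.exp (c * v) ∧ ‖ηr‖ ≤ Real.exp (c * v) ∧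
      ‖η - ηr‖ ≤ c * κ * Real.exp (c * v) ∧ G 1 = η * G 0 * star η := by
  have : ProperSpace 𝔸 := FiniteDimensional.proper ℂ 𝔸
  set K : Set (𝔸 × 𝔸) := {p | p.2 ∈ S ∧ ‖p.1‖ ≤ Real.exp (c * v) ∧ ‖p.2‖ ≤ Real.exp (c * v) ∧
    ‖p.1 - p.2‖ ≤ c * κ * Real.exp (c * v)} with hK
  have hSc : IsClosed (S : Set 𝔸) := (Subalgebra.toSubmodule S).closed_of_finiteDimensional
  have hKc : IsCompact K := by
    refine IsCompact.of_isClosed_subset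
      ((isCompact_closedBall (0 : 𝔸) (Real.exp (c * v))).prod
        (isCompact_closedBall (0 : 𝔸) (Real.exp (c * v)))) ?_ ?_
    · refine (hSc.preimage continuous_snd).inter
        ((isClosed_le continuous_fst.norm continuous_const).inter
          ((isClosed_le continuous_snd.norm continuous_const).inter
            (isClosed_le (continuous_fst.sub continuous_snd).norm continuous_const)))
    · rintro p ⟨-, h1, h2, -⟩
      exact ⟨by simpa using h1, by simpa using h2⟩
  have happrox := fun ε hε => exists_approx_propagator S hc hv hκ hΦ hG hG' hΨS hΦv hΨv hΦΨ
    (ε := ε) hε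
  have hne : K.Nonempty := by
    obtain ⟨η, ηr, hS, h1, h2, h3, -⟩ := happrox 1 one_pos
    exact ⟨(η, ηr), hS, h1, h2, h3⟩
  obtain ⟨⟨η, ηr⟩, ⟨hS, h1, h2, h3⟩, hmin⟩ := hKc.exists_isMinOn hne
    (f := fun p => ‖G 1 - p.1 * G 0 * star p.1‖) (by fun_prop)
  refine ⟨η, ηr, hS, h1, h2, h3, ?_⟩
  rw [← sub_eq_zero, ← norm_le_zero_iff]
  refine le_of_forall_pos_le_add fun ε hε => ?_
  obtain ⟨η', ηr', hS', h1', h2', h3', h4'⟩ := happrox ε hε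
  rw [zero_add]
  exact (hmin (show (η', ηr') ∈ K from ⟨hS', h1', h2', h3'⟩)).trans h4'

end Propagator

/-! ### Exponentials of Hermitian matrices as positive functionals. -/

section TraceBound

variable {n : Type*} [Fintype n] [DecidableEq n]

theorem Matrix.norm_apply_le_l2_opNorm (A : Matrix n n ℂ) (i j : n) : ‖A i j‖ ≤ ‖A‖ := by
  have h := Matrix.l2_opNorm_mulVec A (EuclideanSpace.single j (1 : ℂ))
  rw [PiLp.norm_single, norm_one, mul_one] at h
  refine le_trans ?_ h
  have h2 := PiLp.norm_apply_le (p := 2) (WithLp.toLp 2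
    (A.mulVec (WithLp.ofLp (EuclideanSpace.single j (1 : ℂ))))) i
  refine le_trans (le_of_eq ?_) h2
  simp

theorem Matrix.norm_trace_conj_diagonal_mul_le {U : Matrix n n ℂ} (hU : U ∈ unitary (Matrix n n ℂ))
    {p : n → ℝ} (hp : ∀ i, 0 ≤ p i) (A : Matrix n n ℂ) :
    ‖(U * Matrix.diagonal (fun i => (p i : ℂ)) * star U * A).trace‖ ≤ ‖A‖ * ∑ i, p i := by
  have h1 : ‖star U * A * U‖ = ‖A‖ := by
    rw [CStarRing.norm_mul_mem_unitary _ hU, CStarRing.norm_mem_unitary_mul _ (Unitary.star_mem hU)]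
  have h2 : (U * Matrix.diagonal (fun i => (p i : ℂ)) * star U * A).trace =
      ∑ i, (p i : ℂ) * (star U * A * U) i i := by
    rw [mul_assoc, mul_assoc, Matrix.trace_mul_comm, mul_assoc, Matrix.trace]
    simp [Matrix.diagonal_mul]
  rw [h2, Finset.mul_sum]
  refine (norm_sum_le _ _).trans (Finset.sum_le_sum fun i _ => ?_)
  rw [norm_mul, Complex.norm_real, Real.norm_of_nonneg (hp i), mul_comm, ← h1]
  exact mul_le_mul_of_nonneg_right (Matrix.norm_apply_le_l2_opNorm _ _ _) (hp i)

theorem Matrix.exists_exp_eq_conj_diagonal {M : Matrix n n ℂ} (hM : IsSelfAdjoint M) :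
    ∃ U ∈ unitary (Matrix n n ℂ), ∃ p : n → ℝ, (∀ i, 0 < p i) ∧
      NormedSpace.exp M = U * Matrix.diagonal (fun i => (p i : ℂ)) * star U := by
  obtain ⟨U, e, h1, h2, h3⟩ := Matrix.IsHermitian.exists_diagonalization (H := M) hM
  let u : (Matrix n n ℂ)ˣ := ⟨U, star U, h2, h1⟩
  refine ⟨U, ⟨h1, h2⟩, fun i => Real.exp (e i), fun i => Real.exp_pos _, ?_⟩
  have h := Matrix.exp_units_conj u (Matrix.diagonal fun i => (e i : ℂ))
  rw [Matrix.exp_diagonal] at h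
  conv_lhs => rw [h3]
  refine h.trans ?_
  congr 3
  ext i
  rw [Pi.coe_exp, ← Complex.exp_eq_exp_ℂ, Complex.ofReal_exp]

/-- The exponential of a Hermitian matrix is, up to normalisation, a state. -/
theorem Matrix.trace_exp_bounds [Nonempty n] {M : Matrix n n ℂ} (hM : IsSelfAdjoint M) :
    ∃ z : ℝ, 0 < z ∧ (NormedSpace.exp M).trace = z ∧
      ∀ A : Matrix n n ℂ, ‖(NormedSpace.exp M * A).trace‖ ≤ ‖A‖ * z := by
  obtain ⟨U, hU, p, hp, h⟩ := Matrix.exists_exp_eq_conj_diagonal hM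
  refine ⟨∑ i, p i, Finset.sum_pos (fun i _ => hp i) Finset.univ_nonempty, ?_, fun A => ?_⟩
  · rw [h, mul_assoc, Matrix.trace_mul_comm, mul_assoc, Unitary.star_mul_self_of_mem hU, mul_one,
      Matrix.trace_diagonal]
    push_cast
    rfl
  · rw [h]
    exact Matrix.norm_trace_conj_diagonal_mul_le hU (fun i => (hp i).le) A

end TraceBound

/-! ### Response of the Gibbs state, given an approximate propagator. -/

namespace SpinLattice

open MeasureTheory

variable {ν D : ℕ} {Λ : Finset (Fin ν → ℤ)}

theorem star_evolve {H : Op D Λ} (hH : IsSelfAdjoint H) (t : ℝ) (A : Op D Λ) :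
    star (evolve H t A) = evolve H t (star A) := by
  have h : ∀ c : ℂ, star (NormedSpace.exp (c • H)) = NormedSpace.exp (star c • H) := by
    intro c
    rw [NormedSpace.star_exp, star_smul, hH.star_eq]
  rw [evolve, evolve, star_mul, star_mul, ← neg_smul, h, h, ← mul_assoc]
  simp

theorem isSelfAdjoint_qbpOp (β : ℝ) {H V : Op D Λ} (hH : IsSelfAdjoint H) (hV : IsSelfAdjoint V) :
    IsSelfAdjoint (qbpOp β H V) := by
  have h := (starL' ℝ : Op D Λ ≃L[ℝ] Op D Λ).integral_comp_comm
    (μ := qbpMeasure β) (fun t => evolve H t V)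
  simp only [starL'_apply, star_evolve hH, hV.star_eq] at h
  exact h.symm

/-- The Gibbs state is normalised and of norm one as a functional. -/
theorem gibbs_isState {β : ℝ} [Nonempty (Λ → Fin D)] {H : Op D Λ} (hH : IsSelfAdjoint H) :
    (gibbs β H).trace = 1 ∧ ∀ A : Op D Λ, ‖(gibbs β H * A).trace‖ ≤ ‖A‖ := by
  obtain ⟨z, hz, h1, h2⟩ := Matrix.trace_exp_bounds (M := -(β • H))
    ((IsSelfAdjoint.all β).smul hH).neg
  have hz' : (z : ℂ) ≠ 0 := by exact_mod_cast hz.ne'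
  rw [gibbs, h1]
  refine ⟨by rw [Matrix.trace_smul, h1, smul_eq_mul, inv_mul_cancel₀ hz'], fun A => ?_⟩
  rw [smul_mul_assoc, Matrix.trace_smul, norm_smul, norm_inv, Complex.norm_real,
    Real.norm_of_nonneg hz.le, inv_mul_le_iff₀ hz, mul_comm]
  exact h2 A

theorem norm_star_conj_sub_le {A : Type*} [NormedRing A] [StarRing A] [NormedStarGroup A]
    {η ηr : A} {e d : ℝ} (h1 : ‖η‖ ≤ e) (h2 : ‖ηr‖ ≤ e) (h3 : ‖η - ηr‖ ≤ d) (B : A) :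
    ‖star η * B * η - star ηr * B * ηr‖ ≤ 2 * d * e * ‖B‖ := by
  have he : 0 ≤ e := (norm_nonneg _).trans h1
  have hd : 0 ≤ d := (norm_nonneg _).trans h3
  have h : star η * B * η - star ηr * B * ηr =
      star (η - ηr) * B * η + star ηr * B * (η - ηr) := by
    rw [star_sub]; noncomm_ring
  rw [h]
  calc _ ≤ ‖star (η - ηr)‖ * ‖B‖ * ‖η‖ + ‖star ηr‖ * ‖B‖ * ‖η - ηr‖ :=
        (norm_add_le _ _).trans (add_le_add
          ((norm_mul_le _ _).trans (mul_le_mul_of_nonneg_right (norm_mul_le _ _) (norm_nonneg _)))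
          ((norm_mul_le _ _).trans (mul_le_mul_of_nonneg_right (norm_mul_le _ _) (norm_nonneg _))))
    _ ≤ d * ‖B‖ * e + e * ‖B‖ * d := by
        rw [norm_star, norm_star]
        gcongr
    _ = _ := by ring

theorem exists_qbp_propagator {β : ℝ} [Nonempty (Λ → Fin D)] (hβ : 0 < β) {H V : Op D Λ}
    (hH : IsSelfAdjoint H) (hV : IsSelfAdjoint V) (S : Subalgebra ℂ (Op D Λ)) {Ψ : ℝ → Op D Λ}
    {κ : ℝ} (hκ : 0 ≤ κ) (hΨS : ∀ s ∈ Set.Icc (0 : ℝ) 1, Ψ s ∈ S)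
    (hΨv : ∀ s ∈ Set.Icc (0 : ℝ) 1, ‖Ψ s‖ ≤ ‖V‖)
    (hΦΨ : ∀ s ∈ Set.Icc (0 : ℝ) 1, ‖qbpOp β (H + s • V) V - Ψ s‖ ≤ κ) :
    ∃ η ηr : Op D Λ, ηr ∈ S ∧ ‖η‖ ≤ Real.exp (β / 2 * ‖V‖) ∧ ‖ηr‖ ≤ Real.exp (β / 2 * ‖V‖) ∧
      ‖η - ηr‖ ≤ β / 2 * κ * Real.exp (β / 2 * ‖V‖) ∧
      NormedSpace.exp (-(β • (H + V))) = η * NormedSpace.exp (-(β • H)) * star η := by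
  have hc := (contDiff_expSegment β H V).continuous_deriv le_rfl
  have hd := hasDerivAt_expSegment hβ hH hV
  rw [show deriv (expSegment β H V) = _ from funext fun s => (hd s).deriv] at hc
  have h := exists_propagator S (by positivity) (norm_nonneg V) hκ
    (fun s => isSelfAdjoint_qbpOp β (isSelfAdjoint_segment hH hV s) hV) hd hc hΨS
    (fun s _ => norm_qbpOp_le hβ (isSelfAdjoint_segment hH hV s) V) hΨv hΦΨ
  simpa [expSegment] using h

/-- The propagator is run backwards, from H + V with perturbation -V, and cyclicity of the trace
leaves tr(e^{-β(H+V)} η*η). Only ‖η‖ matters, so the local approximation is the trivial one. -/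
theorem trace_exp_le {β : ℝ} [Nonempty (Λ → Fin D)] (hβ : 0 < β) {H V : Op D Λ}
    (hH : IsSelfAdjoint H) (hV : IsSelfAdjoint V) :
    ‖(NormedSpace.exp (-(β • H))).trace‖ ≤
      Real.exp (β * ‖V‖) * ‖(NormedSpace.exp (-(β • (H + V)))).trace‖ := by
  obtain ⟨η, -, -, h1, -, -, h⟩ := exists_qbp_propagator hβ (hH.add hV) hV.neg ⊥ (Ψ := 0)
    (norm_nonneg V) (fun _ _ => zero_mem _) (fun _ _ => by simp) (fun s _ => by
      have := norm_qbpOp_le hβ (isSelfAdjoint_segment (hH.add hV) hV.neg s) (-V)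
      simpa using this)
  obtain ⟨z, hz, h2, h3⟩ := Matrix.trace_exp_bounds (M := -(β • (H + V)))
    ((IsSelfAdjoint.all β).smul (hH.add hV)).neg
  rw [add_neg_cancel_right] at h
  rw [h, mul_assoc, Matrix.trace_mul_comm, mul_assoc, h2, Complex.norm_real,
    Real.norm_of_nonneg hz.le]
  refine (h3 _).trans (mul_le_mul_of_nonneg_right ?_ hz.le)
  rw [norm_neg] at h1
  refine (norm_mul_le _ _).trans ?_
  rw [norm_star]
  refine (mul_le_mul h1 h1 (norm_nonneg _) (Real.exp_pos _).le).trans_eq ?_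
  rw [← Real.exp_add]
  ring_nf

/-- Locality of the response of the Gibbs state, with an abstract approximation of the propagator
by elements of a star subalgebra that commutes with the observable. -/
theorem norm_trace_gibbs_sub_le {β : ℝ} [Nonempty (Λ → Fin D)] (hβ : 0 < β) {H V : Op D Λ}
    (hH : IsSelfAdjoint H) (hV : IsSelfAdjoint V) (S : StarSubalgebra ℂ (Op D Λ))
    {Ψ : ℝ → Op D Λ} {κ : ℝ} (hκ : 0 ≤ κ) (hΨS : ∀ s ∈ Set.Icc (0 : ℝ) 1, Ψ s ∈ S)
    (hΨv : ∀ s ∈ Set.Icc (0 : ℝ) 1, ‖Ψ s‖ ≤ ‖V‖)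
    (hΦΨ : ∀ s ∈ Set.Icc (0 : ℝ) 1, ‖qbpOp β (H + s • V) V - Ψ s‖ ≤ κ)
    {B : Op D Λ} (hB : ∀ a ∈ S, Commute a B) {C : ℝ} (hC0 : 0 ≤ C)
    (hC : ∀ a ∈ S, ‖cov (gibbs β H) a B‖ ≤ ‖a‖ * ‖B‖ * C) :
    ‖(gibbs β H * B).trace - (gibbs β (H + V) * B).trace‖ ≤
      Real.exp (2 * β * ‖V‖) * ‖B‖ * (C + 2 * β * κ) := by
  obtain ⟨η, ηr, hS, h1, h2, h3, h⟩ :=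
    exists_qbp_propagator hβ hH hV S.toSubalgebra hκ hΨS hΨv hΦΨ
  obtain ⟨hρ1, hρ⟩ := gibbs_isState (β := β) hH
  obtain ⟨z₀, hz₀, ht₀, -⟩ := Matrix.trace_exp_bounds (M := -(β • H))
    ((IsSelfAdjoint.all β).smul hH).neg
  obtain ⟨z₁, hz₁, ht₁, -⟩ := Matrix.trace_exp_bounds (M := -(β • (H + V)))
    ((IsSelfAdjoint.all β).smul (hH.add hV)).neg
  have hz := trace_exp_le hβ hH hV
  rw [ht₀, ht₁, Complex.norm_real, Complex.norm_real, Real.norm_of_nonneg hz₀.le,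
    Real.norm_of_nonneg hz₁.le] at hz
  have hz₀' : (z₀ : ℂ) ≠ 0 := by exact_mod_cast hz₀.ne'
  have hz₁' : (z₁ : ℂ) ≠ 0 := by exact_mod_cast hz₁.ne'
  set E := Real.exp (β / 2 * ‖V‖) with hE
  have hEE : E * E = Real.exp (β * ‖V‖) := by rw [hE, ← Real.exp_add]; ring_nf
  have hEpos : 0 < E := Real.exp_pos _
  set ρ := gibbs β H with hρdef
  have hG₁ : ∀ A : Op D Λ, (gibbs β (H + V) * A).trace =
      (z₀ / z₁ : ℂ) * (ρ * (star η * A * η)).trace := by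
    intro A
    rw [hρdef, gibbs, gibbs, ht₀, ht₁, h, smul_mul_assoc, smul_mul_assoc, Matrix.trace_smul,
      Matrix.trace_smul, smul_eq_mul, smul_eq_mul, ← mul_assoc (z₀ / z₁ : ℂ),
      show (z₀ / z₁ : ℂ) * (z₀ : ℂ)⁻¹ = (z₁ : ℂ)⁻¹ by field_simp]
    congr 1
    rw [mul_assoc, mul_assoc, Matrix.trace_mul_comm η]
    simp only [mul_assoc]
  have hone : (z₀ / z₁ : ℂ) * (ρ * (star η * 1 * η)).trace = 1 := by
    rw [← hG₁, mul_one]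
    exact (gibbs_isState (hH.add hV)).1
  have ha : star ηr * ηr ∈ S := mul_mem (star_mem hS) hS
  have hcomm : star ηr * B * ηr = star ηr * ηr * B := by
    rw [mul_assoc, mul_assoc, (hB ηr hS).eq]
  -- Normalisation of the perturbed state, `hone`, allows tr(ρB) to be multiplied by (z₀/z₁)
  -- tr(ρη*η). Replacing η by η_r in both terms leaves the covariance of η_r*η_r with B and two
  -- errors.
  have hkey : (gibbs β (H + V) * B).trace - (ρ * B).trace = (z₀ / z₁ : ℂ) *
      (cov ρ (star ηr * ηr) B + (ρ * (star η * B * η - star ηr * B * ηr)).trace -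
        (ρ * B).trace * (ρ * (star η * 1 * η - star ηr * 1 * ηr)).trace) := by
    rw [cov, mul_sub ρ, mul_sub ρ, Matrix.trace_sub, Matrix.trace_sub, hG₁, hcomm, mul_one (star ηr),
      mul_assoc ρ]
    linear_combination (ρ * B).trace * hone
  have b1 : ‖(z₀ / z₁ : ℂ)‖ ≤ E * E := by
    rw [norm_div, Complex.norm_real, Complex.norm_real, Real.norm_of_nonneg hz₀.le,
      Real.norm_of_nonneg hz₁.le, div_le_iff₀ hz₁, hEE]
    exact hz
  have b2 : ‖cov ρ (star ηr * ηr) B‖ ≤ E * E * ‖B‖ * C := by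
    refine (hC _ ha).trans ?_
    gcongr
    refine (norm_mul_le _ _).trans ?_
    rw [norm_star]
    gcongr
  have b3 := (hρ _).trans (norm_star_conj_sub_le h1 h2 h3 B)
  have b4 := (hρ _).trans (norm_star_conj_sub_le h1 h2 h3 1)
  rw [norm_one] at b4
  rw [norm_sub_rev, hkey, norm_mul]
  have hβκ : 0 ≤ β / 2 * κ * E := by positivity
  have b5 : ‖cov ρ (star ηr * ηr) B + (ρ * (star η * B * η - star ηr * B * ηr)).trace -
        (ρ * B).trace * (ρ * (star η * 1 * η - star ηr * 1 * ηr)).trace‖ ≤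
      E * E * ‖B‖ * C + 2 * (β / 2 * κ * E) * E * ‖B‖ +
        ‖B‖ * (2 * (β / 2 * κ * E) * E * 1) := by
    refine (norm_sub_le _ _).trans (add_le_add ((norm_add_le _ _).trans (add_le_add b2 b3)) ?_)
    rw [norm_mul]
    exact mul_le_mul (hρ B) b4 (norm_nonneg _) (norm_nonneg _)
  refine (mul_le_mul b1 b5 (norm_nonneg _) (by positivity)).trans_eq ?_
  -- One factor E² bounds the ratio of partition functions, the other comes from the two propagators
  -- around B.
  have hE4 : Real.exp (2 * β * ‖V‖) = E * E * (E * E) := by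
    rw [hEE, ← Real.exp_add]; ring_nf
  rw [hE4]
  ring

end SpinLattice

/-! ### Monomial unitaries. -/

section Monomial

variable {n : Type*} [Fintype n] [DecidableEq n]

/-- The monomial matrix with entries `θ c` at the positions `(c, τ c)`. -/
def Matrix.monomial (θ : n → ℂ) (τ : n ≃ n) : Matrix n n ℂ :=
  Matrix.of fun c d => if d = τ c then θ c else 0

theorem Matrix.monomial_conj_apply (θ : n → ℂ) (τ : n ≃ n) (A : Matrix n n ℂ) (c d : n) :
    (Matrix.monomial θ τ * A * star (Matrix.monomial θ τ)) c d =
      θ c * star (θ d) * A (τ c) (τ d) := by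
  simp only [Matrix.mul_apply, Matrix.monomial, Matrix.star_apply, Matrix.of_apply, ite_mul,
    zero_mul, Finset.sum_ite_eq', Finset.mem_univ, if_true, apply_ite star, star_zero, mul_ite,
    mul_zero]
  ring

theorem Matrix.monomial_mem_unitary {θ : n → ℂ} (hθ : ∀ c, θ c * star (θ c) = 1) (τ : n ≃ n) :
    Matrix.monomial θ τ ∈ unitary (Matrix n n ℂ) := by
  have h : Matrix.monomial θ τ * star (Matrix.monomial θ τ) = 1 := by
    ext c d
    have := Matrix.monomial_conj_apply θ τ 1 c d
    rw [mul_one] at this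
    rw [this, Matrix.one_apply, Matrix.one_apply]
    rcases eq_or_ne c d with rfl | hcd
    · simp only [if_true, mul_one]
      exact hθ c
    · rw [if_neg hcd, if_neg (τ.injective.ne hcd), mul_zero]
  exact ⟨mul_eq_one_comm.mp h, h⟩

end Monomial

/-! ### Local algebras and localisation of the averaged operator. -/

namespace SpinLattice

open MeasureTheory

variable {ν D : ℕ} {Λ : Finset (Fin ν → ℤ)}

theorem embed_apply (X : Finset Λ)
    (A : Matrix ({x : Λ // x ∈ X} → Fin D) ({x : Λ // x ∈ X} → Fin D) ℂ) (c d : Λ → Fin D) :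
    embed X A c d = A (fun x => c x) (fun x => d x) * if ∀ x ∉ X, c x = d x then 1 else 0 := by
  have h : ((fun x : {x : Λ // x ∉ X} => c x.1) = fun x : {x : Λ // x ∉ X} => d x.1) ↔
      ∀ x ∉ X, c x = d x := by
    simp [funext_iff]
  rw [embed, Matrix.submatrix_apply, Matrix.kroneckerMap_apply, Matrix.one_apply]
  congr 1
  exact if_congr h rfl rfl

/-- `embed` as a homomorphism of star algebras. -/
def embedHom (D : ℕ) (X : Finset Λ) :
    Matrix ({x : Λ // x ∈ X} → Fin D) ({x : Λ // x ∈ X} → Fin D) ℂ →⋆ₐ[ℂ] Op D Λ where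
  toFun := embed X
  map_one' := by rw [embed, Matrix.one_kronecker_one, Matrix.submatrix_one_equiv]
  map_mul' A B := by
    rw [embed, embed, embed, Matrix.submatrix_mul_equiv, ← Matrix.mul_kronecker_mul, one_mul]
  map_zero' := by rw [embed, Matrix.zero_kronecker]; rfl
  map_add' A B := by rw [embed, embed, embed, Matrix.add_kronecker]; rfl
  commutes' r := by
    rw [Algebra.algebraMap_eq_smul_one, Algebra.algebraMap_eq_smul_one, embed,
      Matrix.smul_kronecker, Matrix.one_kronecker_one]
    ext c d
    simp only [Matrix.submatrix_apply, Matrix.smul_apply, Matrix.one_apply,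
      (Equiv.injective _).eq_iff]
  map_star' A := by
    rw [embed, embed, Matrix.star_eq_conjTranspose, Matrix.star_eq_conjTranspose,
      Matrix.conjTranspose_submatrix, Matrix.conjTranspose_kronecker, Matrix.conjTranspose_one]

/-- `𝒜_X` as a star subalgebra. -/
def localStarSubalgebra (D : ℕ) (X : Finset Λ) : StarSubalgebra ℂ (Op D Λ) := (embedHom D X).range

theorem mem_localAlgebra_of_apply [NeZero D] {X : Finset Λ} {A : Op D Λ}
    (h0 : ∀ c d : Λ → Fin D, (∃ x ∉ X, c x ≠ d x) → A c d = 0)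
    (h1 : ∀ c d c' d' : Λ → Fin D, (∀ x ∈ X, c x = c' x) → (∀ x ∈ X, d x = d' x) →
      (∀ x ∉ X, c x = d x) → (∀ x ∉ X, c' x = d' x) → A c d = A c' d') :
    A ∈ localAlgebra D X := by
  classical
  -- Any fixed configuration outside X would do in place of 0, since the entries do not depend on
  -- it.
  let glue : ({x : Λ // x ∈ X} → Fin D) → Λ → Fin D := fun u x => if h : x ∈ X then u ⟨x, h⟩ else 0
  refine ⟨Matrix.of fun u w => A (glue u) (glue w), ?_⟩
  ext c d
  rw [embed_apply, Matrix.of_apply]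
  by_cases h : ∀ x ∉ X, c x = d x
  · rw [if_pos h, mul_one]
    refine h1 _ _ _ _ ?_ ?_ ?_ h <;> intro x hx <;> simp [glue, hx]
  · rw [if_neg h, mul_zero]
    push Not at h
    exact (h0 c d h).symm

theorem localAlgebra_mono [NeZero D] {X Y : Finset Λ} (h : X ⊆ Y) :
    localAlgebra D X ⊆ localAlgebra D Y := by
  rintro _ ⟨A, rfl⟩
  refine mem_localAlgebra_of_apply ?_ ?_
  · rintro c d ⟨x, hx, hcd⟩
    rw [embed_apply, if_neg (fun h' => hcd (h' x fun hxX => hx (h hxX))), mul_zero]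
  · intro c d c' d' hc hd h1 h2
    rw [embed_apply, embed_apply]
    have e1 : (fun x : {x : Λ // x ∈ X} => c x.1) = fun x : {x : Λ // x ∈ X} => c' x.1 :=
      funext fun x => hc x (h x.2)
    have e2 : (fun x : {x : Λ // x ∈ X} => d x.1) = fun x : {x : Λ // x ∈ X} => d' x.1 :=
      funext fun x => hd x (h x.2)
    rw [e1, e2]
    congr 1
    refine if_congr (forall₂_congr fun x hx => ?_) rfl rfl
    by_cases hxY : x ∈ Y
    · rw [hc x hxY, hd x hxY]
    · simp [h1 x hxY, h2 x hxY]

theorem embed_monomial (X : Finset Λ) [NeZero D] (θ : ({x : Λ // x ∈ X} → Fin D) → ℂ)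
    (g : {x : Λ // x ∈ X} → Fin D) :
    embed X (Matrix.monomial θ (Equiv.addRight g)) = Matrix.monomial (fun c => θ fun x => c x)
      (Equiv.addRight fun x : Λ => if h : x ∈ X then g ⟨x, h⟩ else 0) := by
  classical
  ext c d
  rw [embed_apply, Matrix.monomial, Matrix.monomial, Matrix.of_apply, Matrix.of_apply,
    Equiv.coe_addRight, Equiv.coe_addRight]
  by_cases h : d = c + fun x : Λ => if h : x ∈ X then g ⟨x, h⟩ else 0
  · subst h
    rw [if_pos rfl, if_pos, if_pos, mul_one]
    · intro x hx; simp [hx]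
    · ext1 x; simp [x.2]
  · rw [if_neg h]
    rw [mul_ite, mul_zero, mul_one, ite_eq_right_iff]
    intro h1
    rw [ite_eq_right_iff]
    intro h2
    refine absurd (funext fun x => ?_) h
    by_cases hx : x ∈ X
    · have := congrFun h2 ⟨x, hx⟩
      simpa [hx] using this
    · simp [hx, h1 x hx]

/-- Approximation of an operator by an operator supported in `X`, from its commutators with the
unitaries supported outside of `X`. -/
theorem exists_local_approx [NeZero D] (X : Finset Λ) (A : Op D Λ) {κ : ℝ}
    (hκ : ∀ U ∈ localAlgebra D Xᶜ, U ∈ unitary (Op D Λ) → ‖A * U - U * A‖ ≤ κ) :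
    ∃ A' ∈ localAlgebra D X, ‖A'‖ ≤ ‖A‖ ∧ ‖A - A'‖ ≤ κ := by
  classical
  let K := {x : Λ // x ∈ Xᶜ} → Fin D
  let ext : K → Λ → Fin D := fun g x => if h : x ∈ Xᶜ then g ⟨x, h⟩ else 0
  let res : (Λ → Fin D) → K := fun c x => c x
  -- Clock-and-shift unitaries on the complement of X: the character gives the phases and the group
  -- element the shift, extended by 0 so that sites of X are untouched.
  let U : AddChar K ℂ × K → Op D Λ := fun i =>
    Matrix.monomial (fun c => i.1 (res c)) (Equiv.addRight (ext i.2))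
  have hψ : ∀ (ψ : AddChar K ℂ) (k : K), star (ψ k) = ψ (-k) := fun ψ k => by
    rw [AddChar.map_neg_eq_conj]; rfl
  have hUloc : ∀ i, U i ∈ localAlgebra D Xᶜ := fun i => ⟨_, embed_monomial Xᶜ i.1 i.2⟩
  have hU : ∀ i, U i ∈ unitary (Op D Λ) := fun i =>
    Matrix.monomial_mem_unitary (fun c => by
      rw [hψ, ← AddChar.map_add_eq_mul, add_neg_cancel, AddChar.map_zero_eq_one]) _
  let N : ℝ := Fintype.card (AddChar K ℂ × K)
  have hN : 0 < N := by
    have : Nonempty (AddChar K ℂ × K) := ⟨(0, 0)⟩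
    exact Nat.cast_pos.mpr Fintype.card_pos
  have hsum : ∀ (f : AddChar K ℂ × K → Op D Λ) (b : ℝ), (∀ i, ‖f i‖ ≤ b) →
      ‖N⁻¹ • ∑ i, f i‖ ≤ b := by
    intro f b hf
    rw [norm_smul, norm_inv, Real.norm_of_nonneg hN.le, inv_mul_le_iff₀ hN]
    refine (norm_sum_le _ _).trans ((Finset.sum_le_sum fun i _ => hf i).trans_eq ?_)
    rw [Finset.sum_const, nsmul_eq_mul, Finset.card_univ]
  refine ⟨N⁻¹ • ∑ i, U i * A * star (U i), ?_, hsum _ _ fun i => ?_, ?_⟩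
  -- Orthogonality of characters kills entries whose configurations differ outside X; the sum over
  -- shifts erases the dependence on their common outside part.
  · have hentry : ∀ c d, (∑ i, U i * A * star (U i)) c d =
        (if res c = res d then (Fintype.card K : ℂ) else 0) *
          ∑ g : K, A (c + ext g) (d + ext g) := by
      intro c d
      rw [Matrix.sum_apply, Fintype.sum_prod_type, Finset.sum_comm, Finset.mul_sum]
      refine Finset.sum_congr rfl fun g _ => ?_
      have h1 := AddChar.sum_apply_eq_ite (res c - res d)
      simp only [sub_eq_zero] at h1
      rw [← h1, Finset.sum_mul]
      refine Finset.sum_congr rfl fun ψ _ => ?_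
      rw [Matrix.monomial_conj_apply, hψ, ← AddChar.map_add_eq_mul, sub_eq_add_neg]
      rfl
    have hmem : (∑ i, U i * A * star (U i)) ∈ localAlgebra D X := by
      refine mem_localAlgebra_of_apply ?_ ?_
      · rintro c d ⟨x, hx, hcd⟩
        rw [hentry, if_neg, zero_mul]
        exact fun h => hcd (congrFun h ⟨x, by simpa using hx⟩)
      · intro c d c' d' hc hd h1 h2
        have r1 : res c = res d := funext fun x => h1 x (Finset.mem_compl.mp x.2)
        have r2 : res c' = res d' := funext fun x => h2 x (Finset.mem_compl.mp x.2)
        rw [hentry, hentry, if_pos r1, if_pos r2]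
        congr 1
        -- Translating the summation variable by the difference of the outside parts carries c to c'
        -- and, as the outside parts agree in pairs, d to d'.
        refine (Fintype.sum_equiv (Equiv.addRight (res c - res c')) _ _ fun g => ?_)
        have e1 : c + ext g = c' + ext (g + (res c - res c')) := by
          ext1 x
          by_cases hx : x ∈ X
          · simp [ext, hx, hc x hx]
          · have hx' : x ∈ Xᶜ := Finset.mem_compl.mpr hx
            simp only [ext, Pi.add_apply, dif_pos hx']
            change c x + g ⟨x, hx'⟩ = c' x + (g ⟨x, hx'⟩ + (c x - c' x))
            abel
        have e2 : d + ext g = d' + ext (g + (res c - res c')) := by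
          ext1 x
          by_cases hx : x ∈ X
          · simp [ext, hx, hd x hx]
          · have hx' : x ∈ Xᶜ := Finset.mem_compl.mpr hx
            simp only [ext, Pi.add_apply, dif_pos hx']
            change d x + g ⟨x, hx'⟩ = d' x + (g ⟨x, hx'⟩ + (c x - c' x))
            rw [h1 x hx, h2 x hx]
            abel
        rw [e1, e2, Equiv.coe_addRight]
    rw [← Complex.coe_smul]
    exact (localStarSubalgebra D X).smul_mem hmem _
  · rw [CStarRing.norm_mul_mem_unitary _ (Unitary.star_mem (hU i)),
      CStarRing.norm_mem_unitary_mul _ (hU i)]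
  -- Since A = A U U*, the error is an average of commutators times unitaries, so no factor is lost.
  · have h : A - N⁻¹ • ∑ i, U i * A * star (U i) =
        N⁻¹ • ∑ i, (A * U i - U i * A) * star (U i) := by
      have hA : A = N⁻¹ • ∑ _i : AddChar K ℂ × K, A := by
        rw [Finset.sum_const, Finset.card_univ, ← Nat.cast_smul_eq_nsmul ℝ, smul_smul,
          inv_mul_cancel₀ hN.ne', one_smul]
      conv_lhs => enter [1]; rw [hA]
      rw [← smul_sub, ← Finset.sum_sub_distrib]
      congr 1
      refine Finset.sum_congr rfl fun i _ => ?_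
      rw [sub_mul, mul_assoc A, Unitary.mul_star_self_of_mem (hU i), mul_one]
    rw [h]
    refine hsum _ _ fun i => ?_
    rw [CStarRing.norm_mul_mem_unitary _ (Unitary.star_mem (hU i))]
    exact hκ _ (hUloc i) (hU i)

theorem zetaQBP_nonneg (ζ : Finset Λ → Finset Λ → ℝ≥0 → ℝ≥0) (β : ℝ) (X : Finset Λ) (r : ℝ) :
    0 ≤ zetaQBP ζ β X r := ENNReal.toReal_nonneg

/-- The commutator is the time average of commutators with the evolved V. For |t| ≤ T the
Lieb-Robinson bound applies; beyond T the trivial bound 2‖V‖ is weighted by the tail of the measure.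
-/
theorem norm_commutator_qbpOp_le [Nonempty (Λ → Fin D)] {β : ℝ} (hβ : 0 < β) {H V : Op D Λ}
    (hH : IsSelfAdjoint H) {X : Finset Λ} (hVX : V ∈ localAlgebra D X)
    {ζ : Finset Λ → Finset Λ → ℝ≥0 → ℝ≥0} (hLR : LiebRobinsonBound H ζ) (r : ℝ) {U : Op D Λ}
    (hUloc : U ∈ localAlgebra D (nbhd X r)ᶜ) (hU : U ∈ unitary (Op D Λ)) :
    ‖qbpOp β H V * U - U * qbpOp β H V‖ ≤ ‖V‖ * zetaQBP ζ β X r := by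
  have := isProbabilityMeasure_qbpMeasure hβ
  have hU1 : ‖U‖ = 1 := CStarRing.norm_of_mem_unitary hU
  have hint := integrable_evolve hH V (qbpMeasure β)
  have hcomm : qbpOp β H V * U - U * qbpOp β H V =
      ∫ t, (evolve H t V * U - U * evolve H t V) ∂(qbpMeasure β) := by
    rw [integral_sub (hint.mul_const U) (hint.const_mul U), integral_mul_const_of_integrable hint,
      integral_const_mul_of_integrable hint]
    rfl
  set f : ℝ → Op D Λ := fun t => evolve H t V * U - U * evolve H t V with hf
  have hf2 : ∀ t, ‖f t‖ₑ ≤ 2 * ‖V‖ₑ := by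
    intro t
    have h : ‖f t‖ ≤ 2 * ‖V‖ := by
      refine (norm_sub_le _ _).trans ?_
      rw [CStarRing.norm_mul_mem_unitary _ hU, CStarRing.norm_mem_unitary_mul _ hU,
        norm_evolve hH]
      linarith
    rw [← ofReal_norm, ← ofReal_norm, ← ENNReal.ofReal_ofNat, ← ENNReal.ofReal_mul (by norm_num)]
    exact ENNReal.ofReal_le_ofReal h
  have hbound2 : ‖∫ t, f t ∂(qbpMeasure β)‖ₑ ≤ 2 * ‖V‖ₑ := by
    refine (enorm_integral_le_lintegral_enorm _).trans ((lintegral_mono hf2).trans ?_)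
    simp
  have hboundT : ∀ T : ℝ≥0, ‖∫ t, f t ∂(qbpMeasure β)‖ₑ ≤
      (eLpNorm (fun t : ℝ => (ζ X (nbhd X r)ᶜ (Real.nnabs t) : ℝ)) ∞
        (volume.restrict (Set.Icc (-(T : ℝ)) (T : ℝ)))
      + ENNReal.ofReal (4 * Real.exp (-(Real.pi / β * (T : ℝ))))) * ‖V‖ₑ := by
    intro T
    set M := eLpNorm (fun t : ℝ => (ζ X (nbhd X r)ᶜ (Real.nnabs t) : ℝ)) ∞
        (volume.restrict (Set.Icc (-(T : ℝ)) (T : ℝ))) with hM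
    have hae : ∀ᵐ t ∂((qbpMeasure β).restrict (Set.Icc (-(T : ℝ)) (T : ℝ))),
        ‖f t‖ₑ ≤ M * ‖V‖ₑ := by
      refine ((qbpMeasure_absolutelyContinuous β).restrict _).ae_le ?_
      have h1 := ae_le_eLpNormEssSup
        (f := fun t : ℝ => (ζ X (nbhd X r)ᶜ (Real.nnabs t) : ℝ))
        (μ := volume.restrict (Set.Icc (-(T : ℝ)) (T : ℝ)))
      filter_upwards [h1] with t ht
      rw [← eLpNorm_exponent_top, ← hM] at ht
      have h2 := hLR X _ V hVX U hUloc t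
      rw [hU1, mul_one] at h2
      calc ‖f t‖ₑ = ENNReal.ofReal ‖f t‖ := (ofReal_norm _).symm
        _ ≤ ENNReal.ofReal (‖V‖ * (ζ X (nbhd X r)ᶜ (Real.nnabs t) : ℝ)) :=
          ENNReal.ofReal_le_ofReal h2
        _ = ‖(ζ X (nbhd X r)ᶜ (Real.nnabs t) : ℝ)‖ₑ * ‖V‖ₑ := by
          rw [mul_comm, ENNReal.ofReal_mul (by positivity), ofReal_norm,
            Real.enorm_eq_ofReal (by positivity)]
        _ ≤ M * ‖V‖ₑ := by gcongr
    refine (enorm_integral_le_lintegral_enorm _).trans ?_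
    rw [← lintegral_add_compl _ (measurableSet_Icc (a := -(T : ℝ)) (b := (T : ℝ))), add_mul]
    refine add_le_add ((lintegral_mono_ae hae).trans ?_) ((lintegral_mono hf2).trans ?_)
    · rw [setLIntegral_const]
      exact mul_le_of_le_one_right' prob_le_one
    · rw [setLIntegral_const, mul_right_comm]
      gcongr
      -- The tail estimate would give 2 here; the constant 4 of `zetaQBP` is not sharp.
      calc 2 * qbpMeasure β (Set.Icc (-(T : ℝ)) T)ᶜ
          ≤ ENNReal.ofReal 4 * ENNReal.ofReal (Real.exp (-(Real.pi / β * T))) := by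
            gcongr
            · rw [ENNReal.ofReal_ofNat]; norm_num
            · exact qbpMeasure_compl_Icc_le hβ T.2
        _ = _ := (ENNReal.ofReal_mul (by norm_num)).symm
  rw [hcomm]
  have hV0 : ‖V‖ₑ = 0 → ‖∫ t, f t ∂(qbpMeasure β)‖ₑ = 0 := fun h => by
    rw [h, mul_zero] at hbound2
    exact le_zero_iff.mp hbound2
  -- The infimum over T is taken in [0,∞], so ‖V‖ is divided out before passing to reals; the case V
  -- = 0 is settled separately.
  have hmain : ‖∫ t, f t ∂(qbpMeasure β)‖ₑ / ‖V‖ₑ ≤ min 2 (⨅ T : ℝ≥0,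
      eLpNorm (fun t : ℝ => (ζ X (nbhd X r)ᶜ (Real.nnabs t) : ℝ)) ∞
        (volume.restrict (Set.Icc (-(T : ℝ)) (T : ℝ)))
      + ENNReal.ofReal (4 * Real.exp (-(Real.pi / β * (T : ℝ))))) :=
    le_min (ENNReal.div_le_of_le_mul hbound2)
      (le_iInf fun T => ENNReal.div_le_of_le_mul (hboundT T))
  have hreal := ENNReal.toReal_mono (ne_top_of_le_ne_top ENNReal.ofNat_ne_top (min_le_left _ _)) hmain
  rw [ENNReal.toReal_div, toReal_enorm, toReal_enorm] at hreal
  rcases eq_or_ne V 0 with rfl | hV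
  · have := hV0 (by simp)
    rw [enorm_eq_zero] at this
    rw [this]
    simp
  · rwa [div_le_iff₀' (norm_pos_iff.mpr hV)] at hreal

/-- Enlarging Y to the complement of X puts both operators in Kronecker form a ⊗ 1 and 1 ⊗ b over
the same splitting. -/
theorem commute_of_disjoint [NeZero D] {X Y : Finset Λ} (hXY : Disjoint X Y) {A B : Op D Λ}
    (hA : A ∈ localAlgebra D X) (hB : B ∈ localAlgebra D Y) : Commute A B := by
  classical
  have hYX : Y ⊆ Xᶜ := fun x hx => Finset.mem_compl.mpr (Finset.disjoint_right.mp hXY hx)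
  obtain ⟨b, rfl⟩ := localAlgebra_mono hYX hB
  obtain ⟨a, rfl⟩ := hA
  let f : ({x : Λ // x ∉ X} → Fin D) → ({x : Λ // x ∈ Xᶜ} → Fin D) :=
    fun u x => u ⟨x.1, Finset.mem_compl.mp x.2⟩
  have hb : embed Xᶜ b =
      ((1 : Matrix ({x : Λ // x ∈ X} → Fin D) ({x : Λ // x ∈ X} → Fin D) ℂ) ⊗ₖ
        b.submatrix f f).submatrix
        (Equiv.piEquivPiSubtypeProd (fun x : Λ => x ∈ X) (fun _ => Fin D))
        (Equiv.piEquivPiSubtypeProd (fun x : Λ => x ∈ X) (fun _ => Fin D)) := by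
    ext c d
    have h : ((fun x : {x : Λ // x ∈ X} => c x.1) = fun x : {x : Λ // x ∈ X} => d x.1) ↔
        ∀ x ∉ Xᶜ, c x = d x := by
      simp [funext_iff]
    rw [embed_apply, Matrix.submatrix_apply, Matrix.kroneckerMap_apply, Matrix.one_apply, mul_comm]
    congr 1
    exact (if_congr h rfl rfl).symm
  rw [hb, Commute, SemiconjBy, embed, Matrix.submatrix_mul_equiv, Matrix.submatrix_mul_equiv,
    ← Matrix.mul_kronecker_mul, ← Matrix.mul_kronecker_mul]
  simp only [one_mul, mul_one]

theorem covSup_nonneg (ρ : Op D Λ) (X Y : Finset Λ) : 0 ≤ covSup ρ X Y := by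
  refine Real.sSup_nonneg ?_
  rintro c ⟨A, -, B, -, -, -, rfl⟩
  exact norm_nonneg _

theorem norm_cov_le (ρ : Op D Λ) {X Y : Finset Λ} {A B : Op D Λ} (hA : A ∈ localAlgebra D X)
    (hB : B ∈ localAlgebra D Y) : ‖cov ρ A B‖ ≤ ‖A‖ * ‖B‖ * covSup ρ X Y := by
  rcases eq_or_ne A 0 with rfl | hA0
  · simp [cov]
  rcases eq_or_ne B 0 with rfl | hB0
  · simp [cov]
  have hA1 := norm_pos_iff.mpr hA0
  have hB1 := norm_pos_iff.mpr hB0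
  have hnorm : ∀ M : Op D Λ, 0 < ‖M‖ → ‖((‖M‖⁻¹ : ℝ) : ℂ) • M‖ = 1 := fun M hM => by
    rw [norm_smul, Complex.norm_real, norm_inv, norm_norm, inv_mul_cancel₀ hM.ne']
  have h : ‖cov ρ (((‖A‖⁻¹ : ℝ) : ℂ) • A) (((‖B‖⁻¹ : ℝ) : ℂ) • B)‖ ≤ covSup ρ X Y :=
    le_csSup (bddAbove_covSet ρ X Y) ⟨_, (localStarSubalgebra D X).smul_mem hA _, _,
      (localStarSubalgebra D Y).smul_mem hB _, hnorm A hA1, hnorm B hB1, rfl⟩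
  have hcov : cov ρ (((‖A‖⁻¹ : ℝ) : ℂ) • A) (((‖B‖⁻¹ : ℝ) : ℂ) • B) =
      ((‖A‖⁻¹ * ‖B‖⁻¹ : ℝ) : ℂ) * cov ρ A B := by
    simp only [cov, mul_smul_comm, smul_mul_assoc, Matrix.trace_smul, smul_eq_mul]
    push_cast
    ring
  rw [hcov, norm_mul, Complex.norm_real, Real.norm_of_nonneg (by positivity), ← mul_inv,
    inv_mul_le_iff₀ (by positivity)] at h
  exact h

/-! ### Overlapping supports. -/

theorem isSelfAdjoint_gibbs [Nonempty (Λ → Fin D)] (β : ℝ) {H : Op D Λ} (hH : IsSelfAdjoint H) :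
    IsSelfAdjoint (gibbs β H) := by
  have hs : IsSelfAdjoint (-(β • H)) := ((IsSelfAdjoint.all β).smul hH).neg
  obtain ⟨z, -, h1, -⟩ := Matrix.trace_exp_bounds hs
  rw [gibbs, h1, IsSelfAdjoint, star_smul, NormedSpace.star_exp, hs.star_eq]
  simp

/-- In every state there is a local unitary with vanishing expectation. -/
theorem exists_unitary_trace_eq_zero (hD : 2 ≤ D) {ρ : Op D Λ} (hρ : IsSelfAdjoint ρ)
    {Z : Finset Λ} (hZ : Z.Nonempty) :
    ∃ W ∈ localAlgebra D Z, W ∈ unitary (Op D Λ) ∧ (ρ * W).trace = 0 := by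
  have : NeZero D := ⟨by omega⟩
  have h10 : (1 : Fin D) ≠ 0 := by
    obtain ⟨k, rfl⟩ := Nat.exists_eq_add_of_le' hD
    exact one_ne_zero
  let m := {x : Λ // x ∈ Z} → Fin D
  -- The reduced density matrix of ρ on Z, determined by tr(ρ(a ⊗ 1)) = tr(aR).
  let R : Matrix m m ℂ := Matrix.of fun j i => (ρ * embedHom D Z (Matrix.single i j 1)).trace
  have hR : R.IsHermitian := by
    ext i j
    rw [Matrix.conjTranspose_apply]
    change star (ρ * embedHom D Z (Matrix.single i j 1)).trace =
      (ρ * embedHom D Z (Matrix.single j i 1)).trace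
    rw [← Matrix.trace_conjTranspose,
      Matrix.conjTranspose_mul, Matrix.trace_mul_comm, ← Matrix.star_eq_conjTranspose,
      ← Matrix.star_eq_conjTranspose, hρ.star_eq, ← map_star, Matrix.star_eq_conjTranspose,
      Matrix.conjTranspose_single, star_one]
  have htr : ∀ a : Matrix m m ℂ, (ρ * embedHom D Z a).trace = (a * R).trace := by
    intro a
    induction a using Matrix.induction_on' with
    | h_zero => simp
    | h_add p q hp hq => simp only [map_add, mul_add, add_mul, Matrix.trace_add, hp, hq]
    | h_std_basis i j x =>
      have hx : Matrix.single i j x = x • Matrix.single i j (1 : ℂ) := by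
        rw [Matrix.smul_single, smul_eq_mul, mul_one]
      rw [hx, map_smul, mul_smul_comm, smul_mul_assoc, Matrix.trace_smul, Matrix.trace_smul]
      congr 1
      rw [Matrix.trace_mul_comm _ R, Matrix.trace_mul_single]
      exact (mul_one _).symm
  obtain ⟨U, e, h1, h2, hRU⟩ := hR.exists_diagonalization
  have hU : U ∈ unitary (Matrix m m ℂ) := ⟨h1, h2⟩
  -- A permutation matrix without fixed points has zero diagonal, so in an eigenbasis of R its
  -- expectation vanishes.
  let P : Matrix m m ℂ := Matrix.monomial (fun _ => 1) (Equiv.addRight 1)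
  have hP : P ∈ unitary (Matrix m m ℂ) := Matrix.monomial_mem_unitary (by simp) _
  have hne : ∀ c : m, c ≠ c + 1 := by
    intro c hc
    obtain ⟨x, hx⟩ := hZ
    have := congrFun hc ⟨x, hx⟩
    exact h10 (left_eq_add.mp this)
  have hW : U * P * star U ∈ unitary (Matrix m m ℂ) :=
    mul_mem (mul_mem hU hP) (Unitary.star_mem hU)
  refine ⟨embedHom D Z (U * P * star U), ⟨_, rfl⟩, Unitary.map_mem (embedHom D Z) hW, ?_⟩
  rw [htr, hRU, show ∀ d : Matrix m m ℂ, U * P * star U * (U * d * star U) =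
    U * (P * (star U * U) * d * star U) by intros; noncomm_ring, h1, mul_one,
    Matrix.trace_mul_comm, mul_assoc, h1, mul_one, Matrix.trace]
  refine Finset.sum_eq_zero fun c _ => ?_
  rw [Matrix.diag_apply, Matrix.mul_diagonal]
  simp [P, Matrix.monomial, hne c]

/-- A unitary W on the overlap with zero expectation belongs to both algebras, and the pair W, W*
has covariance tr(ρWW*) - 0 = 1. -/
theorem one_le_covSup (hD : 2 ≤ D) {ρ : Op D Λ} (hρ : IsSelfAdjoint ρ)
    (hρ1 : ρ.trace = 1) {X Y : Finset Λ} (hXY : ¬ Disjoint X Y) : 1 ≤ covSup ρ X Y := by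
  classical
  have : NeZero D := ⟨by omega⟩
  obtain ⟨W, hWZ, hW, h0⟩ := exists_unitary_trace_eq_zero hD hρ (Z := X ∩ Y)
    (Finset.not_disjoint_iff_nonempty_inter.mp hXY)
  have : Nontrivial (Λ → Fin D) := by
    obtain ⟨x, -⟩ := Finset.not_disjoint_iff_nonempty_inter.mp hXY
    have : Nontrivial (Fin D) := Fin.nontrivial_iff_two_le.mpr hD
    have : Nonempty Λ := ⟨x⟩
    infer_instance
  have hWX := localAlgebra_mono Finset.inter_subset_left hWZ
  have hWY := localAlgebra_mono Finset.inter_subset_right hWZ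
  refine le_csSup (bddAbove_covSet ρ X Y) ⟨W, hWX, star W,
    (localStarSubalgebra D Y).star_mem' hWY, CStarRing.norm_of_mem_unitary hW,
    CStarRing.norm_of_mem_unitary (Unitary.star_mem hW), ?_⟩
  rw [cov, mul_assoc, Unitary.mul_star_self_of_mem hW, mul_one, hρ1, h0]
  simp

theorem gibbs_eq_one [Subsingleton (Λ → Fin D)] (β : ℝ) {H : Op D Λ} (hH : IsSelfAdjoint H) :
    gibbs β H = 1 := by
  ext c d
  obtain rfl := Subsingleton.elim c d
  have : Nonempty (Λ → Fin D) := ⟨c⟩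
  have : Unique (Λ → Fin D) := uniqueOfSubsingleton c
  have h := (gibbs_isState (β := β) hH).1
  rw [Matrix.trace, Fintype.sum_subsingleton _ c, Matrix.diag_apply] at h
  rw [h, Matrix.one_apply_eq]

/-- The response of the Gibbs state is bounded by the norm of the perturbation. -/
theorem norm_trace_gibbs_sub_le_exp [Nonempty (Λ → Fin D)] {β : ℝ} (hβ : 0 < β) {H V : Op D Λ}
    (hH : IsSelfAdjoint H) (hV : IsSelfAdjoint V) (B : Op D Λ) :
    ‖(gibbs β H * B).trace - (gibbs β (H + V) * B).trace‖ ≤ Real.exp (2 * β * ‖V‖) * ‖B‖ := by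
  obtain ⟨hρ1, hρ⟩ := gibbs_isState (β := β) hH
  have hx : 0 ≤ β * ‖V‖ := by positivity
  have hbot : ∀ a ∈ (⊥ : StarSubalgebra ℂ (Op D Λ)), ∃ z : ℂ, a = z • 1 := fun a ha => by
    obtain ⟨z, hz⟩ := StarSubalgebra.mem_bot.mp ha
    exact ⟨z, by rw [← hz, Algebra.algebraMap_eq_smul_one]⟩
  -- For small V the abstract bound is used with scalars as local algebra, Ψ = 0 and κ = ‖V‖:
  -- covariances with scalars vanish, leaving the factor 2β‖V‖ ≤ 1. For large V the trivial bound
  -- 2‖B‖ suffices, since e^{2β‖V‖} ≥ 2.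
  rcases le_total (2 * β * ‖V‖) 1 with h | h
  · refine (norm_trace_gibbs_sub_le hβ hH hV ⊥ (Ψ := 0) (norm_nonneg V)
      (fun _ _ => zero_mem _) (fun _ _ => by simp) (fun s _ => ?_) (B := B) ?_ le_rfl ?_).trans ?_
    · rw [Pi.zero_apply, sub_zero]
      exact norm_qbpOp_le hβ (isSelfAdjoint_segment hH hV s) V
    · intro a ha
      obtain ⟨z, rfl⟩ := hbot a ha
      exact (Commute.one_left B).smul_left z
    · intro a ha
      obtain ⟨z, rfl⟩ := hbot a ha
      have h0 : cov (gibbs β H) (z • 1) B = 0 := by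
        rw [cov, mul_smul_comm, mul_one, smul_mul_assoc, Matrix.trace_smul, Matrix.trace_smul, hρ1,
          smul_eq_mul, smul_eq_mul, mul_one, sub_self]
      rw [h0, norm_zero, mul_zero]
    · rw [zero_add]
      exact mul_le_of_le_one_right (by positivity) h
  · have h1 : 2 ≤ Real.exp (2 * β * ‖V‖) := by linarith [Real.add_one_le_exp (2 * β * ‖V‖)]
    refine (norm_sub_le _ _).trans ((add_le_add (hρ B) ((gibbs_isState (hH.add hV)).2 B)).trans ?_)
    nlinarith [norm_nonneg B]

end SpinLattice

/-! ### Assembly of the bound. -/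

theorem mainTheorem1 {ν D : ℕ} (Λ : Finset (Fin ν → ℤ)) (β : ℝ) (hβ : 0 < β)
    (H : SpinLattice.Op D Λ) (hH : IsSelfAdjoint H)
    (X : Finset Λ) (V : SpinLattice.Op D Λ) (hV : IsSelfAdjoint V)
    (hVX : V ∈ SpinLattice.localAlgebra D X)
    (ζLR : Finset Λ → Finset Λ → ℝ≥0 → ℝ≥0)
    (hLR : ∀ s ∈ Set.Icc (0 : ℝ) 1, SpinLattice.LiebRobinsonBound (H + s • V) ζLR)
    (Y : Finset Λ) (B : SpinLattice.Op D Λ) (hB : B ∈ SpinLattice.localAlgebra D Y)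
    (r : ℝ) (hr : 0 ≤ r) :
    ‖(SpinLattice.gibbs β H * B).trace - (SpinLattice.gibbs β (H + V) * B).trace‖ ≤
      Real.exp (2 * β * ‖V‖) * ‖B‖ *
        (SpinLattice.covSup (SpinLattice.gibbs β H) (SpinLattice.nbhd X r) Y
          + 4 * β * ‖V‖ * SpinLattice.zetaQBP ζLR β X r) := by
  open SpinLattice in
  have hcov := covSup_nonneg (gibbs β H) (nbhd X r) Y
  have hζ := zetaQBP_nonneg ζLR β X r
  have hx : 0 ≤ β * ‖V‖ * zetaQBP ζLR β X r := mul_nonneg (by positivity) hζ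
  -- In dimension at most one both Gibbs states coincide; otherwise D ≥ 2, as the overlapping case
  -- requires.
  rcases subsingleton_or_nontrivial (Λ → Fin D) with hs | hs
  · rw [gibbs_eq_one β hH, gibbs_eq_one β (hH.add hV), sub_self, norm_zero]
    exact mul_nonneg (by positivity) (add_nonneg (covSup_nonneg _ _ _) (by linarith))
  have hD : 2 ≤ D := by
    by_contra hD
    have : Subsingleton (Fin D) := Fin.subsingleton_iff_le_one.mpr (by omega)
    exact not_subsingleton (Λ → Fin D) inferInstance
  have : NeZero D := ⟨by omega⟩
  by_cases hXY : Disjoint (nbhd X r) Y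
  · have happrox : ∀ s : ℝ, ∃ A' ∈ localAlgebra D (nbhd X r), s ∈ Set.Icc (0 : ℝ) 1 →
        ‖A'‖ ≤ ‖V‖ ∧ ‖qbpOp β (H + s • V) V - A'‖ ≤ ‖V‖ * zetaQBP ζLR β X r := by
      intro s
      by_cases hs : s ∈ Set.Icc (0 : ℝ) 1
      · have hHs := isSelfAdjoint_segment hH hV s
        obtain ⟨A', h1, h2, h3⟩ := exists_local_approx (nbhd X r) (qbpOp β (H + s • V) V)
          fun U hU hU' => norm_commutator_qbpOp_le hβ hHs hVX (hLR s hs) r hU hU'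
        exact ⟨A', h1, fun _ => ⟨h2.trans (norm_qbpOp_le hβ hHs V), h3⟩⟩
      -- A filler value: the approximation is needed only for s in [0,1], but `choose` asks for a
      -- function on all of ℝ.
      · exact ⟨0, (localStarSubalgebra D (nbhd X r)).zero_mem, fun h => absurd h hs⟩
    choose Ψ hΨ1 hΨ2 using happrox
    refine (norm_trace_gibbs_sub_le hβ hH hV (localStarSubalgebra D (nbhd X r)) (Ψ := Ψ)
      (mul_nonneg (norm_nonneg V) hζ) (fun s _ => hΨ1 s) (fun s hs => (hΨ2 s hs).1)
      (fun s hs => (hΨ2 s hs).2)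
      (fun a ha => commute_of_disjoint hXY ha hB) hcov (fun a ha => norm_cov_le _ ha hB)).trans ?_
    refine mul_le_mul_of_nonneg_left (add_le_add le_rfl ?_) (by positivity)
    -- The argument yields 2β‖V‖ζ, half of the stated error term.
    linarith
  · refine (norm_trace_gibbs_sub_le_exp hβ hH hV B).trans
      (le_mul_of_one_le_right (by positivity) ?_)
    have h1 := one_le_covSup hD (isSelfAdjoint_gibbs β hH) (gibbs_isState (β := β) hH).1 hXY
    linarith
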